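/- Let $M$ be the 2-sphere $S^2$ or the real projective plane $\mathbb{R}P^2$, let $n\geq 2$, let $F_n(M)=\{(x_1,\ldots,x_n)\in M^n : x_i\neq x_j \text{ for all } i\neq j\}$ be the $n$-th configuration space of $M$, let $\iota_n\colon F_n(M)\to \prod_1^n M$ be the inclusion, and for $1\leq i\leq n$ let $p_i\colon F_n(M)\to M$ be the projection onto the $i$-th coordinate. (a) Let $1\leq i\leq n$. If either $k\geq 3$, or $k=n=2$ and $M=S^2$, then the induced homomorphism $(p_i)_{\#k}\colon \pi_k(F_n(M))\to\pi_k(M)$ is an isomorphism. (b) Let $k\geq 2$. Then the induced homomorphism $(\iota_n)_{\#k}\colon \pi_k(F_n(M))\to\pi_k\bigl(\prod_1^n M\bigr)$ is injective. -/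

import Mathlib

open scoped Topology

namespace SurfaceConf

section InducedMaps

variable {N X Y : Type*} [TopologicalSpace X] [TopologicalSpace Y]

/-- Postcomposition of a generalized loop `I^N → X` based at `x` with a continuous map `f`. -/
def genLoopMap (f : C(X, Y)) (x : X) (p : GenLoop N X x) : GenLoop N Y (f x) :=
  ⟨f.comp p.1, fun y hy => congrArg f (p.2 y hy)⟩

/-- The map of homotopy groups (as pointed sets) induced by a continuous map `f`,
`[p] ↦ [f ∘ p]`. -/
def inducedMap (f : C(X, Y)) (x : X) : HomotopyGroup N X x → HomotopyGroup N Y (f x) :=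
  Quotient.map (genLoopMap f x) fun _ _ h => h.map fun H => H.compContinuousMap f

theorem genLoopMap_transAt [DecidableEq N] (f : C(X, Y)) (x : X) (i : N) (p q : GenLoop N X x) :
    genLoopMap f x (GenLoop.transAt i p q) =
      GenLoop.transAt i (genLoopMap f x p) (genLoopMap f x q) := by
  ext t
  change f (ite _ _ _) = ite _ _ _
  exact apply_ite f _ _ _

/-- The homomorphism `f_# : π_N(X, x) → π_N(Y, f x)` induced by a continuous map `f`, where `π_N`
is the homotopy group indexed by a nonempty finite set `N` of coordinates of the cube. -/
noncomputable def inducedHom [DecidableEq N] [Nonempty N] (f : C(X, Y)) (x : X) :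
    HomotopyGroup N X x →* HomotopyGroup N Y (f x) :=
  MonoidHom.mk' (inducedMap f x) (by
    rintro ⟨p⟩ ⟨q⟩
    let i : N := Classical.arbitrary N
    have h := HomotopyGroup.mul_spec (i := i) (p := p) (q := q)
    have h' := HomotopyGroup.mul_spec (i := i) (p := genLoopMap f x p) (q := genLoopMap f x q)
    refine (congrArg (inducedMap f x) h).trans (Eq.trans ?_ h'.symm)
    exact congrArg (Quotient.mk _) (genLoopMap_transAt f x i q p))

/-- The homomorphism `f_{#k} : π_k(X, x) → π_k(Y, f x)`, for `k ≠ 0`. -/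
noncomputable abbrev piHom (k : ℕ) [NeZero k] (f : C(X, Y)) (x : X) : (π_ k X x) →* (π_ k Y (f x)) :=
  inducedHom f x

end InducedMaps

/-- The unit sphere in `ℝ³`. -/
abbrev S2 : Type := Metric.sphere (0 : EuclideanSpace ℝ (Fin 3)) 1

/-- The equivalence relation on the 2-sphere that identifies antipodal points. -/
def antipodalSetoid : Setoid S2 where
  r x y := x = y ∨ x = -y
  iseqv :=
    { refl := fun _ => Or.inl rfl
      symm := by
        rintro x y (h | h)
        · exact Or.inl h.symm
        · exact Or.inr (by rw [h, neg_neg])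
      trans := by
        rintro x y z (rfl | rfl) (rfl | rfl)
        · exact Or.inl rfl
        · exact Or.inr rfl
        · exact Or.inr rfl
        · exact Or.inl (neg_neg _) }

/-- The real projective plane: the quotient of the 2-sphere by the antipodal map, with the
quotient topology. -/
abbrev RP2 : Type := Quotient antipodalSetoid

section Conf

variable (n : ℕ) (M : Type*) [TopologicalSpace M]

/-- The `n`-th (ordered) configuration space of `M`, a subspace of the `n`-fold product. -/
abbrev Conf : Type _ := {x : Fin n → M // ∀ i j, i ≠ j → x i ≠ x j}

/-- The inclusion of the configuration space in the `n`-fold product. -/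
def confIncl : C(Conf n M, Fin n → M) := ⟨Subtype.val, continuous_subtype_val⟩

/-- The projection of the configuration space onto the `i`-th coordinate. -/
def confProj (i : Fin n) : C(Conf n M, M) :=
  ⟨fun x => x.1 i, (continuous_apply i).comp continuous_subtype_val⟩

end Conf

end SurfaceConf

/-!
Let `M` be the sphere or the projective plane. Everything follows from the statement that each
coordinate projection `F_n(M) → M` is injective on `π_k` for `k ≥ 2` and surjective on `π_k` for
`k ≥ 3` (or for `k = n = 2` and `M = S²`): the projection factors through the inclusion
`F_n(M) → Mⁿ`, which is therefore injective on `π_k` too.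

For the sphere, the projection is a composition of maps that forget one point, starting from
configurations of one point. Forgetting a point is a fibration (Fadell–Neuwirth) whose fibre is a
sphere with a finite nonempty set of punctures. Such a fibre has trivial `π_k` for `k ≥ 2`, and also
for `k = 1` if there is just one puncture, and the exact homotopy sequence gives the claim. For the
projective plane, `F_n(M)` is covered by the space of configurations on the sphere without antipodal
pairs (`SphConf n True`), to which the same argument applies: a further point has to avoid the points
and their antipodes. Coverings do not change `π_k` for `k ≥ 2`.

The homotopy lifting property (`exists_drag`) comes from an
explicit displacement `push` of the sphere that follows a small motion of a configuration; as it
does not move points while the configuration rests, the two exactness statements `piInj_avoidProj`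
and `piSurj_avoidProj` follow directly. Coverings are dealt with by lifting cubes, coordinate by
coordinate for configurations.

The asphericity of the punctured plane (`piTrivial_linePunctured`) is a discrete version of the
contractibility of its universal covering, a tree of half-planes. The punctures may be taken on a
line, which cuts the plane into two half-planes meeting in intervals. A map from a cube lifts to the
covering, and the sheets visited decompose the cube into finitely many closed pieces that are
indexed by vertices of a forest (`Labelling`). By the Tietze extension theorem, the piece of a leaf
can be pushed into the interval towards the root and merged with its neighbour. In the end the
cube is mapped into one half-plane, in which it contracts to the base point.
-/

namespace SurfaceConf

/-! ### Loops on cubes and the maps they induce -/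

section Loops

variable {N X Y Z : Type*} [TopologicalSpace X] [TopologicalSpace Y] [TopologicalSpace Z]

/-- Every `N`-dimensional loop in `X`, at any base point, is null-homotopic: `π_N(X, x)` is trivial
for all `x`. -/
def PiTrivial (N X : Type*) [TopologicalSpace X] : Prop :=
  ∀ (x : X) (p : GenLoop N X x), GenLoop.Homotopic p GenLoop.const

/-- `f` induces a map with trivial kernel on `π_N`, at every base point. -/
def PiInj (N : Type*) (f : C(X, Y)) : Prop :=
  ∀ (x : X) (p : GenLoop N X x), GenLoop.Homotopic (genLoopMap f x p) GenLoop.const →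
    GenLoop.Homotopic p GenLoop.const

/-- `f` induces a surjection on `π_N`, at every base point. -/
def PiSurj (N : Type*) (f : C(X, Y)) : Prop :=
  ∀ (x : X) (q : GenLoop N Y (f x)), ∃ p : GenLoop N X x, GenLoop.Homotopic (genLoopMap f x p) q

theorem homotopic_of_map {x : X} {p q : GenLoop N X x} (H : unitInterval × (N → unitInterval) → X)
    (hc : Continuous H) (h0 : ∀ y, H (0, y) = p y) (h1 : ∀ y, H (1, y) = q y)
    (hb : ∀ t, ∀ y ∈ Cube.boundary N, H (t, y) = x) : GenLoop.Homotopic p q :=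
  ⟨{ toFun := H
     continuous_toFun := hc
     map_zero_left := h0
     map_one_left := h1
     prop' := fun t y hy => (hb t y hy).trans (p.2 y hy).symm }⟩

theorem exists_map_of_homotopic {x : X} {p q : GenLoop N X x} (h : GenLoop.Homotopic p q) :
    ∃ H : C(unitInterval × (N → unitInterval), X), (∀ y, H (0, y) = p y) ∧ (∀ y, H (1, y) = q y) ∧
      ∀ t, ∀ y ∈ Cube.boundary N, H (t, y) = x := by
  obtain ⟨H⟩ := h
  exact ⟨H.toContinuousMap, fun y => H.map_zero_left y, fun y => H.map_one_left y,
    fun t y hy => (H.prop' t y hy).trans (p.2 y hy)⟩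

theorem homotopic_genLoopMap (f : C(X, Y)) {x : X} {p q : GenLoop N X x} (h : GenLoop.Homotopic p q) :
    GenLoop.Homotopic (genLoopMap f x p) (genLoopMap f x q) :=
  h.map fun H => H.compContinuousMap f

theorem PiInj.comp {g : C(Y, Z)} {f : C(X, Y)} (hg : PiInj N g) (hf : PiInj N f) :
    PiInj N (g.comp f) := fun x p h => hf x p (hg (f x) _ h)

theorem PiInj.of_comp {g : C(Y, Z)} {f : C(X, Y)} (h : PiInj N (g.comp f)) : PiInj N f :=
  fun x p hp => h x p (homotopic_genLoopMap g hp)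

theorem PiSurj.comp {g : C(Y, Z)} {f : C(X, Y)} (hg : PiSurj N g) (hf : PiSurj N f) :
    PiSurj N (g.comp f) := fun x q => by
  obtain ⟨r, hr⟩ := hg (f x) q
  obtain ⟨p, hp⟩ := hf x r
  exact ⟨p, (homotopic_genLoopMap g hp).trans hr⟩

theorem PiSurj.of_comp {g : C(Y, Z)} {f : C(X, Y)} (h : PiSurj N (g.comp f))
    (hf : Function.Surjective f) : PiSurj N g := fun y q => by
  obtain ⟨x, rfl⟩ := hf y
  obtain ⟨p, hp⟩ := h x q
  exact ⟨genLoopMap f x p, hp⟩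

theorem PiInj.of_comp_of_piSurj {g : C(Y, Z)} {f : C(X, Y)} (h : PiInj N (g.comp f))
    (hs : PiSurj N f) (hf : Function.Surjective f) : PiInj N g := fun y q hq => by
  obtain ⟨x, rfl⟩ := hf y
  obtain ⟨p, hp⟩ := hs x q
  exact hp.symm.trans
    (homotopic_genLoopMap f (h x p ((homotopic_genLoopMap g hp).trans hq)))

theorem piInj_homeomorph (e : X ≃ₜ Y) : PiInj N (e : C(X, Y)) := fun x p h => by
  obtain ⟨H, h0, h1, hb⟩ := exists_map_of_homotopic h
  refine homotopic_of_map (fun a => e.symm (H a)) (by fun_prop) (fun y => ?_) (fun y => ?_)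
    (fun t y hy => ?_)
  · rw [h0]; exact e.symm_apply_apply _
  · rw [h1]; exact e.symm_apply_apply _
  · rw [hb t y hy]; exact e.symm_apply_apply _

theorem piSurj_homeomorph (e : X ≃ₜ Y) : PiSurj N (e : C(X, Y)) := fun x q => by
  refine ⟨⟨(e.symm : C(Y, X)).comp q.1, fun y hy => ?_⟩, ?_⟩
  · exact (congrArg e.symm (q.2 y hy)).trans (e.symm_apply_apply x)
  · have : genLoopMap (e : C(X, Y)) x ⟨(e.symm : C(Y, X)).comp q.1, fun y hy =>
        (congrArg e.symm (q.2 y hy)).trans (e.symm_apply_apply x)⟩ = q := by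
      ext y; exact e.apply_symm_apply _
    rw [this]

theorem piHom_injective {k : ℕ} [NeZero k] {f : C(X, Y)} (h : PiInj (Fin k) f) (x : X) :
    Function.Injective (piHom k f x) := by
  refine (injective_iff_map_eq_one _).2 ?_
  rintro ⟨p⟩ hp
  have e : (1 : π_ k Y (f x)) = Quotient.mk _ GenLoop.const := HomotopyGroup.one_def
  have e' : (1 : π_ k X x) = Quotient.mk _ GenLoop.const := HomotopyGroup.one_def
  rw [e] at hp
  rw [e']
  exact Quotient.sound (h x p (Quotient.exact hp))

theorem piHom_surjective {k : ℕ} [NeZero k] {f : C(X, Y)} (h : PiSurj (Fin k) f) (x : X) :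
    Function.Surjective (piHom k f x) := by
  rintro ⟨q⟩
  obtain ⟨p, hp⟩ := h x q
  exact ⟨Quotient.mk _ p, Quotient.sound hp⟩

end Loops

/-! ### Lifting loops along covering maps -/

section Covering

open unitInterval

theorem isPreconnected_boundary (N : Type*) [Nontrivial N] :
    IsPreconnected (Cube.boundary N) := by
  classical
  refine isPreconnected_of_forall (0 : N → I) fun y ⟨i, hi⟩ => ?_
  obtain ⟨j, hj⟩ := exists_ne i
  -- the faces `z i = y i` and `z j = 0` are connected and meet
  have face : ∀ (i : N) (a : I), IsPreconnected {z : N → I | z i = a} := fun i a => by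
    have : {z : N → I | z i = a} =
        Set.univ.pi fun k => if k = i then {a} else Set.univ := by
      ext z
      simp only [Set.mem_ofPred_eq, Set.mem_pi, Set.mem_univ, true_implies]
      refine ⟨fun h k => ?_, fun h => by simpa using h i⟩
      split_ifs with hk
      · subst hk; exact h
      · trivial
    rw [this]
    refine isPreconnected_univ_pi fun k => ?_
    split_ifs
    · exact isPreconnected_singleton
    · exact isPreconnected_univ
  refine ⟨{z | z i = y i} ∪ {z | z j = 0}, ?_, Or.inr rfl, Or.inl rfl, ?_⟩
  · rintro z (h | h)
    · exact ⟨i, by rwa [show z i = y i from h]⟩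
    · exact ⟨j, Or.inl h⟩
  · refine IsPreconnected.union (Function.update y j 0) ?_ ?_ (face _ _) (face _ _)
    · simp [Function.update_of_ne hj.symm]
    · simp

variable {N E X : Type*} [TopologicalSpace E] [TopologicalSpace X] {p : E → X}

/-- Cubes lift along coverings, since they contract to a corner. -/
theorem exists_lift_cube (cov : IsCoveringMap p) (f : C(N → I, X)) (e : E) (h : f 0 = p e) :
    ∃ g : C(N → I, E), (∀ y, p (g y) = f y) ∧ g 0 = e := by
  let H : C(I × (N → I), X) := ⟨fun a => f fun i => a.1 * a.2 i, by fun_prop⟩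
  have h0 : ∀ y, H (0, y) = p (ContinuousMap.const _ e y) := fun y => by
    change f (fun i => 0 * y i) = p e
    rw [← h]; congr 1; funext i; simp
  let L := cov.liftHomotopy H (ContinuousMap.const _ e) h0
  have hL : ∀ a, p (L a) = H a := fun a => congrFun (cov.liftHomotopy_lifts H _ h0) a
  refine ⟨⟨fun y => L (1, y), by fun_prop⟩, fun y => ?_, ?_⟩
  · change p (L (1, y)) = f y
    rw [hL]; change f (fun i => 1 * y i) = f y
    congr 1; funext i; simp
  · change L (1, 0) = e
    have hc : ∀ t t' : I, L (t, 0) = L (t', 0) := cov.const_of_comp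
      (g := fun t : I => L (t, 0)) (by fun_prop) fun t t' => by
        rw [hL, hL]; change f (fun i => t * 0) = f (fun i => t' * 0); simp
    rw [hc 1 0]
    exact cov.liftHomotopy_zero H _ h0 0

theorem zero_mem_boundary (N : Type*) [Nonempty N] : (0 : N → I) ∈ Cube.boundary N :=
  ⟨Classical.arbitrary N, Or.inl rfl⟩

/-- Loops of dimension at least two lift to loops, since the boundary of the cube is connected. -/
theorem exists_lift_genLoop [Nontrivial N] (cov : IsCoveringMap p) (e : E) (f : GenLoop N X (p e)) :
    ∃ g : GenLoop N E e, ∀ y, p (g y) = f y := by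
  obtain ⟨g, hg, g0⟩ := exists_lift_cube cov f.1 e (f.2 0 (zero_mem_boundary N))
  refine ⟨⟨g, fun y hy => ?_⟩, hg⟩
  rw [← g0]
  exact cov.constOn_of_comp (isPreconnected_boundary N) g.continuous.continuousOn
    (fun a ha b hb => by rw [hg, hg]; exact (f.2 a ha).trans (f.2 b hb).symm)
    hy (zero_mem_boundary N)

theorem piSurj_of_isCoveringMap [Nontrivial N] {p : C(E, X)} (cov : IsCoveringMap p) : PiSurj N p :=
  fun e f => by
    obtain ⟨g, hg⟩ := exists_lift_genLoop cov e f
    refine ⟨g, ?_⟩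
    rw [show genLoopMap p e g = f from GenLoop.ext _ _ hg]

theorem piInj_of_isCoveringMap [Nonempty N] {p : C(E, X)} (cov : IsCoveringMap p) : PiInj N p :=
  fun e f h => by
    have := (cov.homotopicRel_iff_comp (f₀ := f.1) (f₁ := ContinuousMap.const _ e)
      ⟨0, zero_mem_boundary N, f.2 0 (zero_mem_boundary N)⟩).2
    exact this h

end Covering

/-! ### Pushing points of the sphere along a moving configuration -/

section Push

variable {V : Type*} [NormedAddCommGroup V] [InnerProductSpace ℝ V] {J : Type*} [Fintype J]

/-- The displacement of `z` that drags the ball of radius `ρ` about each `x j` towards `y j`,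
with full strength at the centre `x j` and none at distance `ρ` or more. -/
noncomputable def push (ρ : ℝ) (x y : J → V) (z : V) : V :=
  z + ∑ j, max 0 (1 - ‖z - x j‖ / ρ) • (y j - x j)

theorem push_self (ρ : ℝ) (x : J → V) (z : V) : push ρ x x z = z := by simp [push]

theorem continuous_push {T : Type*} [TopologicalSpace T] {ρ : ℝ} {x y : T → J → V} {z : T → V}
    (hx : ∀ j, Continuous fun t => x t j) (hy : ∀ j, Continuous fun t => y t j)
    (hz : Continuous z) : Continuous fun t => push ρ (x t) (y t) (z t) := by
  unfold push
  fun_prop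

theorem push_eq_single {ρ : ℝ} (hρ : 0 < ρ) {x : J → V} (y : J → V) (z : V)
    (hx : ∀ i j, i ≠ j → 4 * ρ ≤ ‖x i - x j‖) (i : J) (hi : ‖z - x i‖ < ρ) :
    push ρ x y z = z + (1 - ‖z - x i‖ / ρ) • (y i - x i) := by
  unfold push
  rw [Finset.sum_eq_single i]
  · rw [max_eq_right]
    have := (div_lt_one hρ).2 hi
    linarith
  · intro j _ hj
    have h1 := hx i j hj.symm
    have h2 : ‖x i - x j‖ ≤ ‖z - x i‖ + ‖z - x j‖ := by
      rw [← dist_eq_norm, ← dist_eq_norm, ← dist_eq_norm]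
      exact dist_triangle_left _ _ _
    have h3 : 1 ≤ ‖z - x j‖ / ρ := by rw [le_div_iff₀ hρ]; linarith
    rw [max_eq_left (by linarith), zero_smul]
  · simp

theorem push_eq_self {ρ : ℝ} (hρ : 0 < ρ) {x : J → V} (y : J → V) (z : V)
    (hi : ∀ i, ρ ≤ ‖z - x i‖) : push ρ x y z = z := by
  unfold push
  rw [Finset.sum_eq_zero, add_zero]
  intro j _
  have h3 : 1 ≤ ‖z - x j‖ / ρ := by rw [le_div_iff₀ hρ]; linarith [hi j]
  rw [max_eq_left (by linarith), zero_smul]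

theorem norm_push_sub_le {ρ : ℝ} (hρ : 0 < ρ) {x y : J → V} (z : V)
    (hx : ∀ i j, i ≠ j → 4 * ρ ≤ ‖x i - x j‖) (hy : ∀ j, ‖y j - x j‖ ≤ ρ / 10) :
    ‖push ρ x y z - z‖ ≤ ρ / 10 := by
  by_cases h : ∃ i, ‖z - x i‖ < ρ
  · obtain ⟨i, hi⟩ := h
    rw [push_eq_single hρ y z hx i hi, add_sub_cancel_left, norm_smul, Real.norm_eq_abs]
    have h1 := (div_lt_one hρ).2 hi
    have h0 : 0 ≤ ‖z - x i‖ / ρ := by positivity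
    rw [abs_of_nonneg (by linarith)]
    nlinarith [hy i, norm_nonneg (y i - x i)]
  · push Not at h
    rw [push_eq_self hρ y z h]
    simp only [sub_self, norm_zero]
    positivity

/-- On the unit sphere, a point near `x` that is displaced onto the ray through `y` by the bump
of `push` centred at `x` must be `x` itself. -/
theorem eq_of_bump_eq_smul {x y z : V} (hx : ‖x‖ = 1) (hy : ‖y‖ = 1) (hz : ‖z‖ = 1) {ρ l : ℝ}
    (hρ : 0 < ρ) (hρ1 : ρ ≤ 1) (hxy : ‖y - x‖ ≤ ρ / 10) (hl : |l - 1| ≤ ρ / 10)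
    (hd : ‖z - x‖ < ρ) (h : z + (1 - ‖z - x‖ / ρ) • (y - x) = l • y) : z = x := by
  set d := ‖z - x‖ with hdd
  set s := d / ρ with hs
  have hd0 : 0 ≤ d := norm_nonneg _
  have hs0 : 0 ≤ s := by positivity
  have hsd : s * ρ = d := by rw [hs]; field_simp
  have e : z - x = (l - 1) • y + s • (y - x) := by
    have : z = l • y - (1 - s) • (y - x) := by rw [← h]; abel
    rw [this]; module
  have hη := norm_nonneg (y - x)
  set η := ‖y - x‖ with hηd
  have d1 : d ≤ |l - 1| + s * η := by
    calc d = ‖(l - 1) • y + s • (y - x)‖ := by rw [hdd, e]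
      _ ≤ ‖(l - 1) • y‖ + ‖s • (y - x)‖ := norm_add_le _ _
      _ = |l - 1| + s * η := by
        rw [norm_smul, norm_smul, hy, mul_one, Real.norm_eq_abs, Real.norm_eq_abs,
          abs_of_nonneg hs0]
  have sη : s * η ≤ d / 10 := by rw [← hsd]; nlinarith
  have d2 : d ≤ ρ / 5 := by linarith
  -- comparing the lengths of `z` and `x` controls `l - 1` to second order
  have c1 : η ^ 2 = 2 - 2 * inner ℝ x y := by
    rw [hηd, norm_sub_sq_real, hx, hy, real_inner_comm]; ring
  have c2 : d ^ 2 = -2 * inner ℝ x (z - x) := by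
    rw [hdd, norm_sub_sq_real, hx, hz, inner_sub_right, real_inner_self_eq_norm_sq, hx,
      real_inner_comm]; ring
  have c3 : inner ℝ x (z - x) = (l - 1) * inner ℝ x y + s * (inner ℝ x y - 1) := by
    rw [e, inner_add_right, inner_smul_right, inner_smul_right, inner_sub_right,
      real_inner_self_eq_norm_sq, hx]; ring
  set c : ℝ := inner ℝ x y
  have hη1 : η ≤ 1 / 10 := by linarith
  have c4 : (l - 1) * c = s * η ^ 2 / 2 - d ^ 2 / 2 := by
    rw [c1, c2, c3]; ring
  have c5 : 99 / 100 ≤ c := by nlinarith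
  have b1 : s * η ^ 2 ≤ d / 100 := by nlinarith
  have b2 : d ^ 2 ≤ d / 5 := by nlinarith
  have b3 : |l - 1| * c ≤ d / 8 := by
    rw [← abs_of_nonneg (by linarith : (0 : ℝ) ≤ c), ← abs_mul, c4, abs_le]
    constructor <;> nlinarith [mul_nonneg hs0 (sq_nonneg η)]
  have b4 : |l - 1| ≤ d / 4 := by nlinarith [abs_nonneg (l - 1)]
  have : d = 0 := by linarith
  exact sub_eq_zero.1 (norm_eq_zero.1 this)

/-- Pushing along a small displacement `x ↦ y` of well separated unit vectors takes unit vectors off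
the points `x` to vectors off the rays through the points `y`. -/
theorem push_ne_smul {ρ : ℝ} (hρ : 0 < ρ) (hρ1 : ρ ≤ 1) {x y : J → V} {z : V}
    (hx : ∀ j, ‖x j‖ = 1) (hy : ∀ j, ‖y j‖ = 1) (hz : ‖z‖ = 1)
    (hxx : ∀ i j, i ≠ j → 4 * ρ ≤ ‖x i - x j‖) (hxy : ∀ j, ‖y j - x j‖ ≤ ρ / 10)
    (hzx : ∀ j, z ≠ x j) (j : J) {l : ℝ} (hl : 0 ≤ l) : push ρ x y z ≠ l • y j := by
  intro h
  have h1 := norm_push_sub_le hρ z hxx hxy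
  rw [h] at h1
  have h2 : |l - 1| ≤ ρ / 10 := by
    have := abs_norm_sub_norm_le (l • y j) z
    rw [norm_smul, hy, hz, mul_one, Real.norm_of_nonneg hl] at this
    linarith
  have h3 : ‖z - x j‖ < ρ := by
    have e : z - x j = -(l • y j - z) + (l - 1) • y j + (y j - x j) := by module
    have n1 := norm_add_le (-(l • y j - z) + (l - 1) • y j) (y j - x j)
    have n2 := norm_add_le (-(l • y j - z)) ((l - 1) • y j)
    rw [← e] at n1
    rw [norm_neg, norm_smul, hy, mul_one, Real.norm_eq_abs] at n2
    linarith [hxy j]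
  rw [push_eq_single hρ y z hxx j h3] at h
  exact hzx j (eq_of_bump_eq_smul (hx j) (hy j) hz hρ hρ1 (hxy j) h2 h3 h)

theorem push_ne_zero {ρ : ℝ} (hρ : 0 < ρ) (hρ1 : ρ ≤ 1) {x y : J → V} {z : V} (hz : ‖z‖ = 1)
    (hxx : ∀ i j, i ≠ j → 4 * ρ ≤ ‖x i - x j‖) (hxy : ∀ j, ‖y j - x j‖ ≤ ρ / 10) :
    push ρ x y z ≠ 0 := by
  intro h
  have h1 := norm_push_sub_le hρ z hxx hxy
  rw [h, zero_sub, norm_neg, hz] at h1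
  linarith

end Push

section Drag

open unitInterval

variable {J K : Type*} [Fintype J] [PseudoMetricSpace K] [CompactSpace K]

/-- A moving configuration over a compact space stays uniformly separated. -/
theorem exists_separation (c : J → C(I × K, S2)) (hc : ∀ a, Function.Injective fun j => c j a) :
    ∃ ρ : ℝ, 0 < ρ ∧ ρ ≤ 1 ∧ ∀ a i j, i ≠ j →
      4 * ρ ≤ ‖(c i a : EuclideanSpace ℝ (Fin 3)) - c j a‖ := by
  classical
  have key : ∀ p : J × J, ∃ ε : ℝ, 0 < ε ∧ ∀ a, p.1 ≠ p.2 →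
      ε ≤ ‖(c p.1 a : EuclideanSpace ℝ (Fin 3)) - c p.2 a‖ := by
    rintro ⟨i, j⟩
    by_cases hij : i = j
    · exact ⟨1, one_pos, fun _ h => absurd hij h⟩
    have hcont : Continuous fun a => ‖(c i a : EuclideanSpace ℝ (Fin 3)) - c j a‖ := by fun_prop
    obtain ⟨ε, h0, hε⟩ := isCompact_univ.exists_forall_le' (a := 0) hcont.continuousOn
      (fun a _ => norm_pos_iff.2 <| sub_ne_zero.2 fun h => hij (hc a (Subtype.ext h)))
    exact ⟨ε, h0, fun a _ => hε a trivial⟩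
  choose ε h0 hε using key
  obtain ⟨δ, hδ, hδε⟩ : ∃ δ : ℝ, 0 < δ ∧ ∀ p, δ ≤ ε p := by
    rcases isEmpty_or_nonempty (J × J) with h | h
    · exact ⟨1, one_pos, fun p => h.elim p⟩
    · obtain ⟨p, hp⟩ := Finite.exists_min ε
      exact ⟨ε p, h0 p, hp⟩
  refine ⟨min 1 (δ / 4), by positivity, min_le_left _ _, fun a i j hij => ?_⟩
  have := hε (i, j) a hij
  have := hδε (i, j)
  have := min_le_right 1 (δ / 4)
  linarith

theorem exists_small_steps (c : J → C(I × K, S2)) {ε : ℝ} (hε : 0 < ε) :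
    ∃ n : ℕ, 0 < n ∧ ∀ (s t : I) (q : K) (j : J), dist s t ≤ 1 / n →
      ‖(c j (s, q) : EuclideanSpace ℝ (Fin 3)) - c j (t, q)‖ ≤ ε := by
  have hu : UniformContinuous fun (a : I × K) (j : J) => c j a :=
    CompactSpace.uniformContinuous_of_continuous (by fun_prop)
  obtain ⟨δ, hδ, h⟩ := Metric.uniformContinuous_iff.1 hu ε hε
  obtain ⟨n, hn⟩ := exists_nat_one_div_lt hδ
  refine ⟨n + 1, n.succ_pos, fun s t q j hst => ?_⟩
  have := h (a := (s, q)) (b := (t, q)) (by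
    rw [Prod.dist_eq, dist_self, max_eq_left dist_nonneg]
    push_cast at hst
    exact hst.trans_lt hn)
  have h2 := (dist_le_pi_dist (fun j => c j (s, q)) (fun j => c j (t, q)) j).trans this.le
  rwa [Subtype.dist_eq, dist_eq_norm] at h2

/-- The homotopy lifting property of the projection from pairs (a configuration on the sphere,
a further point) to configurations: a point avoiding the start of a moving configuration can be
dragged along so as to avoid it throughout, and it rests while the configuration rests. -/
theorem exists_drag (c : J → C(I × K, S2)) (hc : ∀ a, Function.Injective fun j => c j a)
    (z₀ : C(K, S2)) (hz₀ : ∀ q j, z₀ q ≠ c j (0, q)) :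
    ∃ z : C(I × K, S2), (∀ q, z (0, q) = z₀ q) ∧ (∀ t q j, z (t, q) ≠ c j (t, q)) ∧
      ∀ q, (∀ j t, c j (t, q) = c j (0, q)) → ∀ t, z (t, q) = z₀ q := by
  obtain ⟨ρ, hρ, hρ1, hsep⟩ := exists_separation c hc
  obtain ⟨n, hn, hstep⟩ := exists_small_steps c (ε := ρ / 10) (by positivity)
  -- In the `k`-th of `n` steps the configuration moves during `[k / n, (k + 1) / n]` only.
  let a : ℕ → I := fun k => Set.projIcc 0 1 zero_le_one ((k : ℝ) / n)
  have ha : ∀ k (t : I), dist (min t (a k)) (min t (a (k + 1))) ≤ 1 / n := fun k t => by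
    have h1 : dist (min t (a k)) (min t (a (k + 1))) ≤ dist (a k) (a (k + 1)) := by
      simp only [Subtype.dist_eq, Real.dist_eq]
      have e : ∀ s t : I, ((min s t : I) : ℝ) = min (s : ℝ) t := fun s t =>
        Monotone.map_min (f := fun s : I => (s : ℝ)) fun _ _ h => h
      rw [e, e]
      exact (abs_min_sub_min_le_max _ _ _ _).trans (by simp)
    have h2 : dist (a k) (a (k + 1)) ≤ dist ((k : ℝ) / n) ((k + 1 : ℕ) / n) := by
      simp only [Subtype.dist_eq, Real.dist_eq, a, Set.coe_projIcc]
      refine (abs_max_sub_max_le_max _ _ _ _).trans (max_le (by simp) ?_)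
      exact (abs_min_sub_min_le_max _ _ _ _).trans (by simp)
    refine (h1.trans h2).trans (le_of_eq ?_)
    rw [Real.dist_eq, ← sub_div, abs_div]
    simp
  have step : ∀ k : ℕ, ∃ z : C(I × K, S2), (∀ q, z (0, q) = z₀ q) ∧
      (∀ t q j, z (t, q) ≠ c j (min t (a k), q)) ∧
      ∀ q, (∀ j t, c j (t, q) = c j (0, q)) → ∀ t, z (t, q) = z₀ q := by
    intro k
    induction k with
    | zero =>
      refine ⟨⟨fun b => z₀ b.2, by fun_prop⟩, fun _ => rfl, fun t q j => ?_, fun _ _ _ => rfl⟩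
      have : a 0 = 0 := by simp [a]
      rw [this, min_eq_right unitInterval.nonneg']
      exact hz₀ q j
    | succ k ih =>
      obtain ⟨z, z0, zne, zst⟩ := ih
      let x : I × K → J → EuclideanSpace ℝ (Fin 3) := fun b j => c j (min b.1 (a k), b.2)
      let y : I × K → J → EuclideanSpace ℝ (Fin 3) := fun b j => c j (min b.1 (a (k + 1)), b.2)
      have nS : ∀ w : S2, ‖(w : EuclideanSpace ℝ (Fin 3))‖ = 1 := fun w =>
        mem_sphere_zero_iff_norm.1 w.2
      have hxy : ∀ b j, ‖y b j - x b j‖ ≤ ρ / 10 := fun b j =>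
        hstep _ _ _ _ (by rw [dist_comm]; exact ha k b.1)
      have hxx : ∀ b i j, i ≠ j → 4 * ρ ≤ ‖x b i - x b j‖ := fun b i j h => hsep _ i j h
      have hne : ∀ b, push ρ (x b) (y b) (z b) ≠ 0 := fun b =>
        push_ne_zero hρ hρ1 (nS _) (hxx b) (hxy b)
      have hcont : Continuous fun b => push ρ (x b) (y b) (z b : EuclideanSpace ℝ (Fin 3)) :=
        continuous_push (fun j => by fun_prop) (fun j => by fun_prop) (by fun_prop)
      have hcont' : Continuous fun b =>
          ‖push ρ (x b) (y b) (z b)‖⁻¹ • push ρ (x b) (y b) (z b : EuclideanSpace ℝ (Fin 3)) :=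
        (hcont.norm.inv₀ fun b => norm_ne_zero_iff.2 (hne b)).smul hcont
      have hmem : ∀ b, ‖push ρ (x b) (y b) (z b)‖⁻¹ • push ρ (x b) (y b) (z b) ∈
          Metric.sphere (0 : EuclideanSpace ℝ (Fin 3)) 1 := fun b => by
        rw [mem_sphere_zero_iff_norm, norm_smul, norm_inv, norm_norm,
          inv_mul_cancel₀ (norm_ne_zero_iff.2 (hne b))]
      let w : C(I × K, S2) := ⟨fun b => ⟨_, hmem b⟩, hcont'.subtype_mk _⟩
      have wst : ∀ b, x b = y b → w b = z b := fun b h => Subtype.ext <| by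
        change ‖push ρ (x b) (y b) (z b)‖⁻¹ • push ρ (x b) (y b) (z b) = _
        rw [h, push_self, nS, inv_one, one_smul]
      refine ⟨w, fun q => ?_, fun t q j h => ?_, fun q hq t => ?_⟩
      · rw [wst, z0]
        funext j
        change ((c j (min 0 (a k), q) : S2) : EuclideanSpace ℝ (Fin 3)) = c j (min 0 (a (k + 1)), q)
        rw [min_eq_left unitInterval.nonneg', min_eq_left unitInterval.nonneg']
      · have hzx : ∀ j, (z (t, q) : EuclideanSpace ℝ (Fin 3)) ≠ x (t, q) j := fun j h =>
          zne t q j (Subtype.ext h)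
        refine push_ne_smul hρ hρ1 (fun j => nS _) (fun j => nS _) (nS _) (hxx (t, q))
          (hxy (t, q)) hzx j (norm_nonneg (push ρ (x (t, q)) (y (t, q)) (z (t, q)))) ?_
        have h' : ‖push ρ (x (t, q)) (y (t, q)) (z (t, q))‖⁻¹ •
            push ρ (x (t, q)) (y (t, q)) (z (t, q)) = y (t, q) j := congrArg Subtype.val h
        change _ = _ • y (t, q) j
        rw [← h', smul_smul, mul_inv_cancel₀ (norm_ne_zero_iff.2 (hne _)), one_smul]
      · rw [wst, zst q hq]
        funext j
        simp only [x, y]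
        rw [hq j, hq j (min t (a (k + 1)))]
  obtain ⟨z, z0, zne, zst⟩ := step n
  have han : a n = 1 := by
    have : (n : ℝ) / n = 1 := div_self (by positivity)
    simp [a, this]
  refine ⟨z, z0, fun t q j => ?_, zst⟩
  have := zne t q j
  rwa [han, min_eq_left unitInterval.le_one'] at this

end Drag

/-! ### Adding a point to a configuration on the sphere -/

section Avoid

open unitInterval

variable {J B N : Type*} [TopologicalSpace B]

/-- The complement in the sphere of the points `a j`. -/
abbrev Punctured (a : J → S2) : Type := {z : S2 // ∀ j, z ≠ a j}

/-- For a family of configurations `c · b` on the sphere parametrized by `b : B`, the space of pairs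
of a parameter `b` and a point of the sphere that is not in the configuration `c · b`. -/
abbrev AvoidSpace (c : J → C(B, S2)) : Type _ := {p : B × S2 // ∀ j, p.2 ≠ c j p.1}

/-- The projection of `AvoidSpace c` onto the parameter. -/
def avoidProj (c : J → C(B, S2)) : C(AvoidSpace c, B) :=
  ⟨fun p => p.1.1, by fun_prop⟩

/-- The inclusion of the fibre of `avoidProj c` over `b`. -/
def avoidFiber (c : J → C(B, S2)) (b : B) : C(Punctured fun j => c j b, AvoidSpace c) :=
  ⟨fun z => ⟨(b, z.1), z.2⟩, by fun_prop⟩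

variable [Fintype J]

theorem exists_avoid_lift {K : Type*} [PseudoMetricSpace K] [CompactSpace K]
    (c : J → C(B, S2)) (hc : ∀ b, Function.Injective fun j => c j b)
    (H : C(I × K, B)) (z₀ : C(K, S2)) (hz₀ : ∀ q j, z₀ q ≠ c j (H (0, q))) :
    ∃ z : C(I × K, S2), (∀ q, z (0, q) = z₀ q) ∧ (∀ t q j, z (t, q) ≠ c j (H (t, q))) ∧
      ∀ q, (∀ t, H (t, q) = H (0, q)) → ∀ t, z (t, q) = z₀ q := by
  obtain ⟨z, h0, hne, hst⟩ := exists_drag (fun j => (c j).comp H) (fun a => hc (H a)) z₀ hz₀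
  exact ⟨z, h0, hne, fun q hq => hst q fun j t => congrArg (c j) (hq t)⟩

variable [Fintype N]

/-- The part `π_N(fibre) → π_N(total space) → π_N(base)` of the exact sequence, for a trivial
`π_N(fibre)`. -/
theorem piInj_avoidProj (c : J → C(B, S2)) (hc : ∀ b, Function.Injective fun j => c j b)
    (hF : ∀ b, PiTrivial N (Punctured fun j => c j b)) : PiInj N (avoidProj c) := by
  intro e p h
  obtain ⟨H, H0, H1, Hb⟩ := exists_map_of_homotopic h
  change ∀ y, H (1, y) = e.1.1 at H1
  change ∀ y, H (0, y) = (p y).1.1 at H0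
  change ∀ t, ∀ y ∈ Cube.boundary N, H (t, y) = e.1.1 at Hb
  have hp : Continuous fun y => (p y).1.2 := (continuous_snd.comp continuous_subtype_val).comp p.1.2
  obtain ⟨z, z0, zne, zst⟩ := exists_avoid_lift c hc H ⟨fun y => (p y).1.2, hp⟩ fun q j => by
    rw [H0]; exact (p q).2 j
  have zb : ∀ t, ∀ y ∈ Cube.boundary N, z (t, y) = e.1.2 := fun t y hy => by
    rw [zst y fun t => (Hb t y hy).trans (Hb 0 y hy).symm]
    exact congrArg (fun a => a.1.2) (p.2 y hy)
  let r : GenLoop N (Punctured fun j => c j e.1.1) ⟨e.1.2, e.2⟩ :=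
    ⟨⟨fun y => ⟨z (1, y), fun j => by have := zne 1 y j; rwa [H1] at this⟩, by fun_prop⟩,
      fun y hy => Subtype.ext (zb 1 y hy)⟩
  have h1 : GenLoop.Homotopic p (genLoopMap (avoidFiber c e.1.1) _ r) :=
    homotopic_of_map (fun a => ⟨(H a, z a), zne a.1 a.2⟩) (by fun_prop)
      (fun y => Subtype.ext (Prod.ext (H0 y) (z0 y)))
      (fun y => Subtype.ext (Prod.ext (H1 y) rfl))
      (fun t y hy => Subtype.ext (Prod.ext (Hb t y hy) (zb t y hy)))
  exact h1.trans (homotopic_genLoopMap _ (hF _ _ r))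

/-- The part `π_N(total space) → π_N(base) → π_{N∖i}(fibre)` of the exact sequence, for a trivial
`π_{N∖i}(fibre)`. -/
theorem piSurj_avoidProj [DecidableEq N] (i : N) (c : J → C(B, S2))
    (hc : ∀ b, Function.Injective fun j => c j b)
    (hF : ∀ b, PiTrivial {j // j ≠ i} (Punctured fun j => c j b)) : PiSurj N (avoidProj c) := by
  intro e q
  have qb : ∀ y ∈ Cube.boundary N, q.1 y = e.1.1 := q.2
  let H : C(I × ({j // j ≠ i} → I), B) := q.1.comp (Cube.insertAt i)
  have H0 : ∀ y, H (0, y) = e.1.1 := fun y => qb _ (Cube.insertAt_boundary i (Or.inl (Or.inl rfl)))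
  have H1 : ∀ y, H (1, y) = e.1.1 := fun y => qb _ (Cube.insertAt_boundary i (Or.inl (Or.inr rfl)))
  have Hb : ∀ t, ∀ y ∈ Cube.boundary _, H (t, y) = e.1.1 := fun t y hy =>
    qb _ (Cube.insertAt_boundary i (Or.inr hy))
  obtain ⟨z, z0, zne, zst⟩ := exists_avoid_lift c hc H (ContinuousMap.const _ e.1.2) fun y j => by
    rw [H0]; exact e.2 j
  have zb : ∀ t, ∀ y ∈ Cube.boundary _, z (t, y) = e.1.2 := fun t y hy =>
    zst y (fun t => (Hb t y hy).trans (Hb 0 y hy).symm) t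
  let r : GenLoop {j // j ≠ i} (Punctured fun j => c j e.1.1) ⟨e.1.2, e.2⟩ :=
    ⟨⟨fun y => ⟨z (1, y), fun j => by have := zne 1 y j; rwa [H1] at this⟩, by fun_prop⟩,
      fun y hy => Subtype.ext (zb 1 y hy)⟩
  obtain ⟨G, G0, G1, Gb⟩ := exists_map_of_homotopic (hF _ _ r)
  -- `L` follows the lift `z` at double speed and then the null-homotopy `G` of its end.
  let α : I → I := fun t => Set.projIcc 0 1 zero_le_one (2 * (t : ℝ))
  let β : I → I := fun t => Set.projIcc 0 1 zero_le_one (2 * (t : ℝ) - 1)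
  have hα : Continuous α := by fun_prop
  have hβ : Continuous β := by fun_prop
  have α0 : α 0 = 0 := by simp [α]
  have α1 : ∀ t : I, (1 / 2 : ℝ) ≤ t → α t = 1 := fun t ht =>
    Set.projIcc_of_right_le _ (by linarith)
  have β1 : β 1 = 1 := Set.projIcc_of_right_le _ (by norm_num)
  have β0 : ∀ t : I, (t : ℝ) = 1 / 2 → β t = 0 := fun t ht =>
    Set.projIcc_of_le_left _ (by linarith)
  let L : I × ({j // j ≠ i} → I) → S2 := fun a =>
    if (a.1 : ℝ) ≤ 1 / 2 then z (α a.1, a.2) else (G (β a.1, a.2)).1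
  have hL : Continuous L := by
    refine Continuous.if_le (by fun_prop) (by fun_prop) (by fun_prop) continuous_const ?_
    intro a ha
    rw [α1 _ ha.ge, β0 _ ha, G0]
    rfl
  have Lne : ∀ a j, L a ≠ c j (H (α a.1, a.2)) := fun a j => by
    by_cases ha : (a.1 : ℝ) ≤ 1 / 2
    · simp only [L, if_pos ha]
      exact zne _ _ _
    · simp only [L, if_neg ha]
      rw [α1 _ (not_le.1 ha).le, H1]
      exact (G (β a.1, a.2)).2 j
  have L0 : ∀ y, L (0, y) = e.1.2 := fun y => by
    simp only [L, Set.Icc.coe_zero, one_div, inv_nonneg, Nat.ofNat_nonneg, if_true, α0]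
    exact z0 y
  have L1 : ∀ y, L (1, y) = e.1.2 := fun y => by
    have : ¬ ((1 : I) : ℝ) ≤ 1 / 2 := by norm_num
    simp only [L, if_neg this, β1]
    exact congrArg Subtype.val (G1 y)
  have Lb : ∀ t, ∀ y ∈ Cube.boundary _, L (t, y) = e.1.2 := fun t y hy => by
    by_cases ht : (t : ℝ) ≤ 1 / 2
    · simp only [L, if_pos ht]
      exact zb _ y hy
    · simp only [L, if_neg ht]
      exact congrArg Subtype.val (Gb _ y hy)
  have split : ∀ x ∈ Cube.boundary N, x i = 0 ∨ x i = 1 ∨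
      (Cube.splitAt i x).2 ∈ Cube.boundary {j // j ≠ i} := by
    rintro x ⟨k, hk⟩
    by_cases h : k = i
    · subst h; tauto
    · exact Or.inr (Or.inr ⟨⟨k, h⟩, hk⟩)
  let P : GenLoop N (AvoidSpace c) e :=
    ⟨⟨fun x => ⟨(H (α (x i), (Cube.splitAt i x).2), L (Cube.splitAt i x)), Lne _⟩, by fun_prop⟩,
      fun x hx => by
        refine Subtype.ext (Prod.ext ?_ ?_)
        · change H (α (x i), (Cube.splitAt i x).2) = e.1.1
          rcases split x hx with h | h | h
          · rw [h, α0, H0]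
          · rw [h, α1 1 (by norm_num), H1]
          · exact Hb _ _ h
        · change L (x i, (Cube.splitAt i x).2) = e.1.2
          rcases split x hx with h | h | h
          · rw [h, L0]
          · rw [h, L1]
          · exact Lb _ _ h⟩
  let μ : I × I → I := fun a => ⟨(1 - a.1) * α a.2 + a.1 * a.2, by
    have := (convex_Icc (0 : ℝ) 1) (α a.2).2 a.2.2 (a := 1 - (a.1 : ℝ)) (b := a.1)
      (by linarith [a.1.2.2]) a.1.2.1 (by ring)
    simpa using this⟩
  have hμ : Continuous μ := by fun_prop
  refine ⟨P, homotopic_of_map (fun a => H (μ (a.1, a.2 i), (Cube.splitAt i a.2).2)) (by fun_prop)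
    (fun x => ?_) (fun x => ?_) fun s x hx => ?_⟩
  · have : μ (0, x i) = α (x i) := Subtype.ext (by simp [μ])
    simp only [this]
    rfl
  · have : μ (1, x i) = x i := Subtype.ext (by simp [μ])
    simp only [this]
    change q.1 (Cube.insertAt i (Cube.splitAt i x)) = q.1 x
    exact congrArg q.1 ((Cube.splitAt i).symm_apply_apply x)
  · change H (μ (s, x i), _) = e.1.1
    rcases split x hx with h | h | h
    · have : μ (s, x i) = 0 := Subtype.ext (by simp [μ, h, α0])
      rw [this, H0]
    · have : μ (s, x i) = 1 := Subtype.ext (by simp [μ, h, α1 1 (by norm_num)])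
      rw [this, H1]
    · exact Hb _ _ h

end Avoid

/-! ### The plane punctured along a line: arcs in half-planes -/

/-- The plane without the points `(a, 0)`, `a ∈ P`. -/
abbrev LinePunctured (P : Set ℝ) : Type := {p : ℝ × ℝ // p.2 ≠ 0 ∨ p.1 ∉ P}

/-- The sign of a half-plane: `true` is the upper and `false` the lower half-plane. -/
def sgn (s : Bool) : ℝ := if s then 1 else -1

theorem sgn_not (s : Bool) : sgn (!s) = -sgn s := by cases s <;> simp [sgn]

theorem sgn_mul_self (s : Bool) : sgn s * sgn s = 1 := by cases s <;> simp [sgn]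

theorem sgn_ne_zero (s : Bool) : sgn s ≠ 0 := by cases s <;> simp [sgn]

/-- A closed half-plane, without its punctures. -/
def half (P : Set ℝ) (s : Bool) : Set (LinePunctured P) := {p | 0 ≤ sgn s * p.1.2}

section Arcs

variable {P : Set ℝ}

theorem isClosed_half (s : Bool) : IsClosed (half P s) :=
  isClosed_le continuous_const (by fun_prop)

theorem exists_mem_half (p : LinePunctured P) : ∃ s, p ∈ half P s := by
  rcases le_total 0 p.1.2 with h | h
  · exact ⟨true, by simpa [half, sgn] using h⟩
  · exact ⟨false, by simpa [half, sgn] using h⟩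

/-- Arcs joining `p` to `q`, bulging into the half-plane of sign `s`. -/
def arc (s : Bool) (t : ℝ) (p q : ℝ × ℝ) : ℝ × ℝ :=
  ((1 - t) * p.1 + t * q.1, (1 - t) * p.2 + t * q.2 + sgn s * (t * (1 - t) * |p.1 - q.1|))

theorem arc_zero (s : Bool) (p q : ℝ × ℝ) : arc s 0 p q = p := by simp [arc]

theorem arc_one (s : Bool) (p q : ℝ × ℝ) : arc s 1 p q = q := by simp [arc]

theorem arc_self (s : Bool) (t : ℝ) (p : ℝ × ℝ) : arc s t p p = p := by
  ext <;> simp [arc] <;> ring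

theorem arc_mem {s : Bool} {t : ℝ} (ht : t ∈ Set.Icc (0 : ℝ) 1) {p q : LinePunctured P}
    (hp : p ∈ half P s) (hq : q ∈ half P s) :
    (arc s t p.1 q.1).2 ≠ 0 ∨ (arc s t p.1 q.1).1 ∉ P := by
  rcases ht.1.eq_or_lt with h0 | h0
  · rw [← h0, arc_zero]; exact p.2
  rcases ht.2.eq_or_lt with h1 | h1
  · rw [h1, arc_one]; exact q.2
  by_cases hpq : p = q
  · rw [hpq, arc_self]; exact q.2
  left
  intro h
  -- the height of the arc is a sum of nonnegative terms, which all vanish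
  have hp' : 0 ≤ sgn s * p.1.2 := hp
  have hq' : 0 ≤ sgn s * q.1.2 := hq
  have e : (1 - t) * (sgn s * p.1.2) + t * (sgn s * q.1.2) + t * (1 - t) * |p.1.1 - q.1.1| = 0 := by
    have e1 : sgn s * ((1 - t) * p.1.2 + t * q.1.2 + sgn s * (t * (1 - t) * |p.1.1 - q.1.1|)) = 0 := by
      rw [show (1 - t) * p.1.2 + t * q.1.2 + sgn s * (t * (1 - t) * |p.1.1 - q.1.1|) = 0 from h,
        mul_zero]
    linear_combination e1 - t * (1 - t) * |p.1.1 - q.1.1| * sgn_mul_self s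
  have a1 : 0 ≤ (1 - t) * (sgn s * p.1.2) := mul_nonneg (by linarith) hp'
  have a2 : 0 ≤ t * (sgn s * q.1.2) := mul_nonneg h0.le hq'
  have htt : 0 < t * (1 - t) := mul_pos h0 (by linarith)
  have a3 : 0 ≤ t * (1 - t) * |p.1.1 - q.1.1| := mul_nonneg htt.le (abs_nonneg _)
  have b1 : p.1.2 = 0 := by
    have : (1 - t) * (sgn s * p.1.2) = 0 := by linarith
    rcases mul_eq_zero.1 this with h | h
    · linarith
    · exact (mul_eq_zero.1 h).resolve_left (sgn_ne_zero s)
  have b2 : q.1.2 = 0 := by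
    have : t * (sgn s * q.1.2) = 0 := by linarith
    rcases mul_eq_zero.1 this with h | h
    · linarith
    · exact (mul_eq_zero.1 h).resolve_left (sgn_ne_zero s)
  have b3 : p.1.1 = q.1.1 := by
    have : t * (1 - t) * |p.1.1 - q.1.1| = 0 := by linarith
    exact sub_eq_zero.1 (abs_eq_zero.1 ((mul_eq_zero.1 this).resolve_left htt.ne'))
  exact hpq (Subtype.ext (Prod.ext b3 (b1.trans b2.symm)))

theorem continuous_arc {T : Type*} [TopologicalSpace T] (s : Bool) {t : T → ℝ} {p q : T → ℝ × ℝ}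
    (ht : Continuous t) (hp : Continuous p) (hq : Continuous q) :
    Continuous fun a => arc s (t a) (p a) (q a) := by
  unfold arc; fun_prop

end Arcs

/-! ### The tree of reduced words -/

/-- Reduced words: lists without equal neighbours. They are the vertices of the Cayley tree of the
free product of copies of `ℤ/2` indexed by `A`. -/
abbrev Word (A : Type*) : Type _ := {l : List A // l.IsChain (· ≠ ·)}

section Words

variable {A : Type*}

open Classical in
/-- Multiplication of a reduced word by the letter `a` from the left; letters are involutions. -/
noncomputable def toggle (a : A) : List A → List A
  | [] => [a]
  | b :: l => if a = b then l else a :: b :: l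

theorem isChain_toggle (a : A) {l : List A} (h : l.IsChain (· ≠ ·)) :
    (toggle a l).IsChain (· ≠ ·) := by
  cases l with
  | nil => simp [toggle]
  | cons b l =>
    simp only [toggle]
    split_ifs with hab
    · exact h.tail
    · exact List.isChain_cons_cons.2 ⟨hab, h⟩

theorem toggle_toggle (a : A) {l : List A} (h : l.IsChain (· ≠ ·)) : toggle a (toggle a l) = l := by
  cases l with
  | nil => simp [toggle]
  | cons b l =>
    by_cases hab : a = b
    · subst hab
      cases l with
      | nil => simp [toggle]
      | cons c l => simp [toggle, (List.isChain_cons_cons.1 h).1]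
    · simp [toggle, hab]

/-- The action of a letter on reduced words. -/
noncomputable def Word.toggle (a : A) (w : Word A) : Word A :=
  ⟨SurfaceConf.toggle a w.1, isChain_toggle a w.2⟩

theorem Word.toggle_toggle (a : A) (w : Word A) : (w.toggle a).toggle a = w :=
  Subtype.ext (SurfaceConf.toggle_toggle a w.2)

/-- The empty word. -/
def Word.nil : Word A := ⟨[], by simp⟩

end Words

/-! ### Peeling off leaves -/

section Peel

open unitInterval

variable {P : Set ℝ} {K : Type*} [TopologicalSpace K]

/-- The punctures to the left of `t`, which tell apart the intervals of the punctured line. -/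
def leftOf (P : Set ℝ) (t : ℝ) : Set ℝ := P ∩ Set.Iio t

theorem ordConnected_leftOf (A : Set ℝ) : Set.OrdConnected {t | t ∉ P ∧ leftOf P t = A} := by
  refine ⟨fun a ⟨ha, haA⟩ b ⟨hb, hbA⟩ t ⟨h1, h2⟩ => ⟨fun ht => ?_, ?_⟩⟩
  · have hb' : t ∈ leftOf P b := ⟨ht, lt_of_le_of_ne h2 (by rintro rfl; exact hb ht)⟩
    rw [hbA, ← haA] at hb'
    exact absurd hb'.2 (not_lt.2 h1)
  · refine Set.Subset.antisymm ?_ ?_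
    · rw [← hbA]; exact Set.inter_subset_inter_right _ (Set.Iio_subset_Iio h2)
    · rw [← haA]; exact Set.inter_subset_inter_right _ (Set.Iio_subset_Iio h1)

/-- A decomposition of `K` into closed pieces, indexed by the half-planes of the covering of the
punctured plane: a vertex `(s, w)` stands for the sheet `w` over the half-plane of sign `s`, and
`(s, w)` is joined to `(!s, w.toggle a)` by an edge labelled `a`, which makes a forest. Only the
vertices in the finite set `S` have nonempty pieces. A piece is mapped by `f` into the half-plane
of its vertex, and two pieces meet only if their vertices are adjacent, and then only at points
mapped to the interval that labels the edge. -/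
structure Labelling (f : C(K, LinePunctured P)) (S : Finset (Bool × Word (Set ℝ))) where
  /-- The piece of a vertex. -/
  piece : Bool × Word (Set ℝ) → Set K
  isClosed_piece : ∀ v, IsClosed (piece v)
  exists_mem : ∀ q, ∃ v, q ∈ piece v
  mem_of_mem : ∀ {v q}, q ∈ piece v → v ∈ S
  mem_half : ∀ {v q}, q ∈ piece v → f q ∈ half P v.1
  adj : ∀ {v w q}, q ∈ piece v → q ∈ piece w → v ≠ w →
    (f q).1.2 = 0 ∧ w = (!v.1, v.2.toggle (leftOf P (f q).1.1))

/-- A map with a labelling can be deformed into the half-plane of the root, without moving the piece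
of the root. A leaf of the finite forest of nonempty pieces meets the other pieces only over a
single interval; as an interval is an absolute extensor, the leaf can be pushed into it and merged
with the neighbouring piece. -/
theorem Labelling.exists_homotopicRel [PreconnectedSpace K] [NormalSpace K] {R : Set K}
    (hR : R.Nonempty) (s₀ : Bool) (S : Finset (Bool × Word (Set ℝ))) :
    ∀ {f : C(K, LinePunctured P)} (L : Labelling f S), R ⊆ L.piece (s₀, Word.nil) →
      ∃ f' : C(K, LinePunctured P), f.HomotopicRel f' R ∧ ∀ q, f' q ∈ half P s₀ := by
  classical
  induction S using Finset.strongInduction with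
  | H S ih =>
  intro f L hL
  by_cases hS : ∀ v ∈ S, v = (s₀, Word.nil)
  · refine ⟨f, ContinuousMap.HomotopicRel.refl f, fun q => ?_⟩
    obtain ⟨v, hv⟩ := L.exists_mem q
    have := L.mem_half hv
    rwa [hS v (L.mem_of_mem hv)] at this
  push Not at hS
  obtain ⟨r, hr⟩ := hR
  have hrS : (s₀, Word.nil) ∈ S := L.mem_of_mem (hL hr)
  -- a vertex other than the root, as far away from the root as possible
  obtain ⟨v, hv, hmax⟩ := Finset.exists_max_image (S.erase (s₀, Word.nil)) (fun v => v.2.1.length)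
    (by obtain ⟨v, hv, hne⟩ := hS; exact ⟨v, Finset.mem_erase.2 ⟨hne, hv⟩⟩)
  obtain ⟨hv0, hvS⟩ := Finset.mem_erase.1 hv
  by_cases hne : (L.piece v).Nonempty
  swap
  · refine ih (S.erase v) (Finset.erase_ssubset hvS)
      ⟨L.piece, L.isClosed_piece, L.exists_mem, fun {w q} hw => ?_, L.mem_half, L.adj⟩ hL
    refine Finset.mem_erase.2 ⟨?_, L.mem_of_mem hw⟩
    rintro rfl
    exact hne ⟨q, hw⟩
  -- the union of the other pieces
  let C : Set K := ⋃ w ∈ S.erase v, L.piece w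
  have hC : IsClosed C := isClosed_biUnion_finset fun w _ => L.isClosed_piece w
  have hCmem : ∀ {w q}, w ≠ v → q ∈ L.piece w → q ∈ C := fun {w q} h hq =>
    Set.mem_biUnion (Finset.mem_coe.2 (Finset.mem_erase.2 ⟨h, L.mem_of_mem hq⟩)) hq
  have hunion : L.piece v ∪ C = Set.univ := by
    refine Set.eq_univ_of_forall fun q => ?_
    obtain ⟨w, hw⟩ := L.exists_mem q
    by_cases h : w = v
    · subst h; exact Or.inl hw
    · exact Or.inr (hCmem h hw)
  have hmeet : (L.piece v ∩ C).Nonempty := by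
    have hp := isPreconnected_univ (α := K)
    rw [isPreconnected_closed_iff] at hp
    have := hp _ _ (L.isClosed_piece v) hC hunion.ge (by simpa using hne)
      (by simpa using ⟨r, hCmem hv0.symm (hL hr)⟩)
    simpa using this
  -- the vertex `v` is a leaf, so the letter `j` of the edge towards the root is the same everywhere
  obtain ⟨j, l, hjl⟩ : ∃ j l, v.2.1 = j :: l := by
    obtain ⟨q, hqv, hqC⟩ := hmeet
    obtain ⟨w, hw, hqw⟩ := Set.mem_iUnion₂.1 hqC
    obtain ⟨hwv, hwS⟩ := Finset.mem_erase.1 hw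
    cases h : v.2.1 with
    | cons j l => exact ⟨j, l, rfl⟩
    | nil =>
      exfalso
      have e := (L.adj hqv hqw hwv.symm).2
      have e2 : w.2.1 = [leftOf P (f q).1.1] := by
        rw [e]; change SurfaceConf.toggle _ v.2.1 = _; rw [h]; rfl
      have := hmax w (Finset.mem_erase.2 ⟨by rintro rfl; simp [Word.nil] at e2, hwS⟩)
      rw [h, e2] at this
      simp at this
  let u : Bool × Word (Set ℝ) := (!v.1, ⟨l, by have := v.2.2; rw [hjl] at this; exact this.tail⟩)
  have huv : u ≠ v := fun h => by
    have := congrArg Prod.fst h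
    simp [u] at this
  have hleaf : ∀ {w q}, q ∈ L.piece v → q ∈ L.piece w → w ≠ v →
      w = u ∧ (f q).1.2 = 0 ∧ leftOf P (f q).1.1 = j := fun {w q} hqv hqw hwv => by
    obtain ⟨h0, e⟩ := L.adj hqv hqw hwv.symm
    have e2 : w.2.1 = SurfaceConf.toggle (leftOf P (f q).1.1) (j :: l) := by
      rw [e, ← hjl]; rfl
    by_cases hj : leftOf P (f q).1.1 = j
    · refine ⟨?_, h0, hj⟩
      rw [hj] at e2
      simp only [SurfaceConf.toggle, if_true] at e2
      exact Prod.ext (by rw [e]) (Subtype.ext e2)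
    · exfalso
      simp only [SurfaceConf.toggle, if_neg hj] at e2
      have := hmax w (Finset.mem_erase.2 ⟨by rintro rfl; simp [Word.nil] at e2, L.mem_of_mem hqw⟩)
      rw [hjl, e2] at this
      simp at this
  have hnotP : ∀ {q}, (f q).1.2 = 0 → (f q).1.1 ∉ P := fun {q} h => (f q).2.resolve_left (by simpa)
  have hedge : ∀ {q}, q ∈ L.piece v ∩ C →
      (f q).1.2 = 0 ∧ (f q).1.1 ∈ {t | t ∉ P ∧ leftOf P t = j} := fun {q} ⟨hqv, hqC⟩ => by
    obtain ⟨w, hw, hqw⟩ := Set.mem_iUnion₂.1 hqC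
    obtain ⟨-, h0, hj⟩ := hleaf hqv hqw (Finset.mem_erase.1 hw).1
    exact ⟨h0, hnotP h0, hj⟩
  -- extend the map of the common part into the interval of the edge over all of `K`
  have hord := ordConnected_leftOf (P := P) j
  obtain ⟨g, hg, hgf⟩ := ContinuousMap.exists_restrict_eq_forall_mem_of_closed
    (s := L.piece v ∩ C) (⟨fun q => (f q).1.1, by fun_prop⟩ : C(↑(L.piece v ∩ C), ℝ))
    (t := {t | t ∉ P ∧ leftOf P t = j})
    (fun q => (hedge q.2).2) (by obtain ⟨q, hq⟩ := hmeet; exact ⟨_, (hedge hq).2⟩)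
    ((L.isClosed_piece v).inter hC)
  have hgf' : ∀ {q}, q ∈ L.piece v ∩ C → f q = (⟨(g q, 0), Or.inr (hg q).1⟩ : LinePunctured P) :=
    fun {q} hq => Subtype.ext (Prod.ext (DFunLike.congr_fun hgf ⟨q, hq⟩).symm (hedge hq).1)
  have hghalf : ∀ q s, (⟨(g q, 0), Or.inr (hg q).1⟩ : LinePunctured P) ∈ half P s := fun q s => by
    simp [half]
  let H : I × K → ℝ × ℝ := fun a =>
    if a.2 ∈ L.piece v then arc v.1 a.1 (f a.2).1 (g a.2, 0) else (f a.2).1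
  have hHC : ∀ a : I × K, a.2 ∈ C → H a = (f a.2).1 := fun a ha => by
    by_cases h : a.2 ∈ L.piece v
    · simp only [H, if_pos h]
      have := congrArg Subtype.val (hgf' ⟨h, ha⟩)
      rw [this]
      exact arc_self _ _ _
    · simp only [H, if_neg h]
  have hHv : ∀ a : I × K, a.2 ∈ L.piece v → H a = arc v.1 a.1 (f a.2).1 (g a.2, 0) :=
    fun a h => if_pos h
  have hHcont : Continuous H := by
    rw [← continuousOn_univ, ← Set.preimage_univ (f := (Prod.snd : I × K → K)), ← hunion,
      Set.preimage_union]
    refine ContinuousOn.union_of_isClosed ?_ ?_ ((L.isClosed_piece v).preimage continuous_snd)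
      (hC.preimage continuous_snd)
    · exact (continuous_arc v.1 (by fun_prop) (by fun_prop) (by fun_prop)).continuousOn.congr
        fun a ha => hHv a ha
    · exact (by fun_prop : Continuous fun a : I × K => (f a.2).1).continuousOn.congr
        fun a ha => hHC a ha
  have hHmem : ∀ a, (H a).2 ≠ 0 ∨ (H a).1 ∉ P := fun a => by
    by_cases h : a.2 ∈ L.piece v
    · rw [hHv a h]
      exact arc_mem (q := ⟨(g a.2, 0), Or.inr (hg a.2).1⟩) a.1.2 (L.mem_half h) (hghalf _ _)
    · simp only [H, if_neg h]
      exact (f a.2).2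
  let f₁ : C(K, LinePunctured P) := ⟨fun q => ⟨H (1, q), hHmem _⟩, by fun_prop⟩
  have hf₁v : ∀ {q}, q ∈ L.piece v → f₁ q = ⟨(g q, 0), Or.inr (hg q).1⟩ := fun {q} hq =>
    Subtype.ext ((hHv (1, q) hq).trans (arc_one _ _ _))
  have hf₁ : ∀ {q}, q ∉ L.piece v → f₁ q = f q := fun {q} hq => Subtype.ext (if_neg hq)
  have hhom : f.HomotopicRel f₁ R := ⟨{
    toFun := fun a => ⟨H a, hHmem a⟩
    continuous_toFun := by fun_prop
    map_zero_left := fun q => Subtype.ext <| by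
      by_cases h : q ∈ L.piece v
      · exact (hHv (0, q) h).trans (arc_zero _ _ _)
      · exact if_neg h
    map_one_left := fun q => rfl
    prop' := fun t q hq => Subtype.ext (hHC (t, q) (hCmem hv0.symm (hL hq))) }⟩
  -- the piece of `v` is now joined to the piece of its neighbour `u`
  let piece' : Bool × Word (Set ℝ) → Set K := fun w =>
    if w = v then ∅ else if w = u then L.piece u ∪ L.piece v else L.piece w
  have hp : ∀ {w q}, q ∈ piece' w ↔ w ≠ v ∧ (q ∈ L.piece w ∨ (w = u ∧ q ∈ L.piece v)) := by
    intro w q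
    simp only [piece']
    split_ifs with h1 h2
    · simp [h1]
    · simp [h2, huv]
    · simp [h1, h2]
  have huS : u ∈ S := by
    obtain ⟨q, hqv, hqC⟩ := hmeet
    obtain ⟨w, hw, hqw⟩ := Set.mem_iUnion₂.1 hqC
    rw [← (hleaf hqv hqw (Finset.mem_erase.1 hw).1).1]
    exact L.mem_of_mem hqw
  let L' : Labelling f₁ (S.erase v) :=
    { piece := piece'
      isClosed_piece := fun w => by
        simp only [piece']
        split_ifs
        · exact isClosed_empty
        · exact (L.isClosed_piece _).union (L.isClosed_piece _)
        · exact L.isClosed_piece _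
      exists_mem := fun q => by
        obtain ⟨w, hw⟩ := L.exists_mem q
        by_cases h : w = v
        · subst h; exact ⟨u, hp.2 ⟨huv, Or.inr ⟨rfl, hw⟩⟩⟩
        · exact ⟨w, hp.2 ⟨h, Or.inl hw⟩⟩
      mem_of_mem := fun {w q} hq => by
        obtain ⟨h1, h2 | ⟨rfl, -⟩⟩ := hp.1 hq
        · exact Finset.mem_erase.2 ⟨h1, L.mem_of_mem h2⟩
        · exact Finset.mem_erase.2 ⟨h1, huS⟩
      mem_half := fun {w q} hq => by
        by_cases hqv : q ∈ L.piece v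
        · rw [hf₁v hqv]; exact hghalf _ _
        · rw [hf₁ hqv]
          obtain ⟨-, h2 | h2⟩ := hp.1 hq
          · exact L.mem_half h2
          · exact absurd h2.2 hqv
      adj := fun {w w' q} hq hq' hww => by
        obtain ⟨h1, h2⟩ := hp.1 hq
        obtain ⟨h1', h2'⟩ := hp.1 hq'
        have hqv : q ∉ L.piece v := fun hqv => hww <| by
          have e : w = u := by
            rcases h2 with h2 | h2
            · exact (hleaf hqv h2 h1).1
            · exact h2.1
          have e' : w' = u := by
            rcases h2' with h2 | h2
            · exact (hleaf hqv h2 h1').1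
            · exact h2.1
          rw [e, e']
        rw [hf₁ hqv]
        exact L.adj (h2.resolve_right fun h => hqv h.2) (h2'.resolve_right fun h => hqv h.2) hww }
  obtain ⟨f', h1, h2⟩ := ih (S.erase v) (Finset.erase_ssubset hvS) L' fun q hq =>
    hp.2 ⟨hv0.symm, Or.inl (hL hq)⟩
  exact ⟨f', hhom.trans h1, h2⟩

end Peel

/-! ### Universal coverings of punctured planes -/

section Cover

variable {P : Set ℝ}

instance {A : Type*} : TopologicalSpace (Word A) := ⊥

instance {A : Type*} : DiscreteTopology (Word A) := ⟨rfl⟩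

/-- The open half-plane of sign `s`, together with the vertical lines through the points of the
horizontal axis that are not punctures. -/
def chart (P : Set ℝ) (s : Bool) : Set (LinePunctured P) := {p | 0 < sgn s * p.1.2 ∨ p.1.1 ∉ P}

theorem half_subset_chart (s : Bool) : half P s ⊆ chart P s := fun p hp => by
  rcases (show 0 ≤ sgn s * p.1.2 from hp).eq_or_lt with h | h
  · have : p.1.2 = 0 := (mul_eq_zero.1 h.symm).resolve_left (sgn_ne_zero s)
    exact Or.inr (p.2.resolve_left (by simpa))
  · exact Or.inl h

theorem isOpen_chart (hP : P.Finite) (s : Bool) : IsOpen (chart P s) := by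
  have h1 : IsOpen {p : LinePunctured P | 0 < sgn s * p.1.2} :=
    isOpen_lt continuous_const (by fun_prop)
  have h2 : IsOpen {p : LinePunctured P | p.1.1 ∉ P} :=
    hP.isClosed.isOpen_compl.preimage (f := fun p : LinePunctured P => p.1.1) (by fun_prop)
  exact h1.union h2

theorem fst_notMem_of_mem_chart {s : Bool} {p : LinePunctured P} (h : p ∈ chart P s)
    (h' : p ∈ chart P !s) : p.1.1 ∉ P := by
  rcases h with h | h
  · rcases h' with h' | h'
    · rw [sgn_not] at h'; linarith
    · exact h'
  · exact h

theorem eventually_leftOf_eq (hP : P.Finite) {t : ℝ} (ht : t ∉ P) :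
    ∀ᶠ t' in 𝓝 t, leftOf P t' = leftOf P t := by
  have : ∀ᶠ t' in 𝓝 t, ∀ a ∈ P, (a < t' ↔ a < t) := by
    rw [Filter.eventually_all_finite hP]
    intro a ha
    rcases lt_or_gt_of_ne (show a ≠ t by rintro rfl; exact ht ha) with h | h
    · filter_upwards [lt_mem_nhds h] with t' h' using ⟨fun _ => h, fun _ => h'⟩
    · filter_upwards [gt_mem_nhds h] with t' h'
      exact ⟨fun h2 => absurd h2 (not_lt.2 h'.le), fun h2 => absurd h2 (not_lt.2 h.le)⟩
  filter_upwards [this] with t' h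
  ext a
  exact and_congr_right fun ha => h a ha

open Classical in
/-- Gluing data of a covering of the punctured plane, each component of which is a universal
covering: the sheets over either chart are indexed by reduced words, and the passage from one chart
to the other through an interval of the punctured line multiplies by the letter of that interval.
Letters are arbitrary sets of reals, so that the covering has many components; only the component
of the chosen starting point matters to a lift. -/
noncomputable def coverCore (hP : P.Finite) :
    FiberBundleCore Bool (LinePunctured P) (Word (Set ℝ)) where
  baseSet := chart P
  isOpen_baseSet := isOpen_chart hP
  indexAt p := if p ∈ chart P true then true else false
  mem_baseSet_at p := by
    split_ifs with h
    · exact h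
    · obtain ⟨s, hs⟩ := exists_mem_half p
      cases s
      · exact half_subset_chart _ hs
      · exact absurd (half_subset_chart _ hs) h
  coordChange s s' p w := if s = s' then w else w.toggle (leftOf P p.1.1)
  coordChange_self s p _ w := if_pos rfl
  continuousOn_coordChange s s' := by
    by_cases h : s = s'
    · simpa only [if_pos h] using continuous_snd.continuousOn
    · simp only [if_neg h]
      have h' : s' = !s := by cases s <;> cases s' <;> simp_all
      subst h'
      rintro ⟨p, w⟩ ⟨⟨h1, h2⟩, -⟩
      refine ContinuousAt.continuousWithinAt ?_
      refine (continuousAt_const (y := w.toggle (leftOf P p.1.1))).congr ?_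
      have e1 : ∀ᶠ a : LinePunctured P × Word (Set ℝ) in 𝓝 (p, w),
          leftOf P a.1.1.1 = leftOf P p.1.1 :=
        (show Continuous fun a : LinePunctured P × Word (Set ℝ) => a.1.1.1 by
          fun_prop).continuousAt.eventually
          (eventually_leftOf_eq hP (fst_notMem_of_mem_chart h1 h2))
      have e2 : ∀ᶠ a : LinePunctured P × Word (Set ℝ) in 𝓝 (p, w), a.2 = w :=
        (continuous_snd.tendsto (p, w)).eventually (p := fun b => b = w) (by rw [nhds_discrete]; simp)
      filter_upwards [e1, e2] with a h1 h2
      rw [h1, h2]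
  coordChange_comp s s' s'' p _ w := by
    cases s <;> cases s' <;> cases s'' <;> simp [Word.toggle_toggle]

end Cover

section Labels

open unitInterval

variable {P : Set ℝ} {N : Type*} [Nontrivial N]

/-- A loop of dimension at least two lifts to a loop in the covering space `coverCore`, and the
sheets through which the lift passes give a labelling of the cube. -/
theorem exists_labelling (hP : P.Finite) {x : LinePunctured P} (f : GenLoop N (LinePunctured P) x) :
    ∃ (s : Bool) (S : Finset (Bool × Word (Set ℝ))) (L : Labelling f.1 S),
      x ∈ half P s ∧ Cube.boundary N ⊆ L.piece (s, Word.nil) := by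
  classical
  obtain ⟨s₀, hs₀⟩ := exists_mem_half x
  let Z := coverCore hP
  have cov : IsCoveringMap Z.proj := FiberBundle.isCoveringMap
  -- the label of a point of the covering in a chart
  let lab : Bool → Z.TotalSpace → Word (Set ℝ) := fun s e => (Z.localTriv s e).2
  have hlab : ∀ s e, lab s e = Z.coordChange (Z.indexAt e.1) s e.1 e.2 := fun s e => rfl
  have hbase : ∀ p : LinePunctured P, p ∈ chart P (Z.indexAt p) := Z.mem_baseSet_at
  let e : Z.TotalSpace := ⟨x, Z.coordChange s₀ (Z.indexAt x) x Word.nil⟩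
  have he : lab s₀ e = Word.nil := by
    rw [hlab]
    change Z.coordChange (Z.indexAt x) s₀ x (Z.coordChange s₀ (Z.indexAt x) x Word.nil) = _
    rw [Z.coordChange_comp _ _ _ _ ⟨⟨half_subset_chart _ hs₀, hbase x⟩, half_subset_chart _ hs₀⟩,
      Z.coordChange_self _ _ (half_subset_chart _ hs₀)]
  obtain ⟨g, hg⟩ := exists_lift_genLoop cov e (show GenLoop N (LinePunctured P) (Z.proj e) from f)
  have hg' : ∀ q, (g q).1 = f q := hg
  have labst : ∀ s q, f q ∈ chart P s → ∀ᶠ q' in 𝓝 q, lab s (g q') = lab s (g q) := by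
    intro s q hq
    have h1 : ContinuousAt (Z.localTriv s) (g q) :=
      (Z.localTriv s).toOpenPartialHomeomorph.continuousAt
        ((Z.localTriv s).mem_source.2 (by change (g q).1 ∈ chart P s; rwa [hg']))
    have h2 : ContinuousAt (fun q' => lab s (g q')) q :=
      continuous_snd.continuousAt.comp
        (ContinuousAt.comp (f := fun q' => g q') h1 g.1.continuous.continuousAt)
    exact h2.eventually (p := fun b => b = lab s (g q)) (by rw [nhds_discrete]; simp)
  -- near any point, the labels are constant on each of the two half-planes
  have hloc : ∀ q, ∀ᶠ q' in 𝓝 q, ∀ s, f q' ∈ half P s → lab s (g q') = lab s (g q) := by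
    intro q
    rw [Filter.eventually_all]
    intro s
    by_cases h : f q ∈ half P s
    · filter_upwards [labst s q (half_subset_chart s h)] with q' hq' _ using hq'
    · have : ∀ᶠ q' in 𝓝 q, f q' ∉ half P s :=
        f.1.continuous.continuousAt.eventually ((isClosed_half s).isOpen_compl.mem_nhds h)
      filter_upwards [this] with q' h1 h2 using absurd h2 h1
  choose! V hV using fun q => Filter.eventually_iff_exists_mem.1 (hloc q)
  obtain ⟨F, hF⟩ := CompactSpace.elim_nhds_subcover V fun q => (hV q).1
  have hFmem : ∀ q s, f q ∈ half P s → ∃ q₀ ∈ F, lab s (g q) = lab s (g q₀) := fun q s h => by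
    have : q ∈ ⋃ q₀ ∈ F, V q₀ := by rw [hF]; trivial
    obtain ⟨q₀, hq₀, hq⟩ := Set.mem_iUnion₂.1 this
    exact ⟨q₀, hq₀, (hV q₀).2 q hq s h⟩
  refine ⟨s₀, (Finset.univ ×ˢ F).image fun a => (a.1, lab a.1 (g a.2)),
    { piece := fun v => {q | f q ∈ half P v.1 ∧ lab v.1 (g q) = v.2}
      isClosed_piece := fun v => ?_
      exists_mem := fun q => ?_
      mem_of_mem := fun {v q} hq => ?_
      mem_half := fun hq => hq.1
      adj := fun {v w q} hq hq' hvw => ?_ }, hs₀, fun q hq => ?_⟩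
  · rw [← isOpen_compl_iff, isOpen_iff_mem_nhds]
    intro q hq
    by_cases h : f q ∈ half P v.1
    · filter_upwards [labst v.1 q (half_subset_chart _ h)] with q' h' h2
      exact hq ⟨h, h'.symm.trans h2.2⟩
    · have : ∀ᶠ q' in 𝓝 q, f q' ∉ half P v.1 :=
        f.1.continuous.continuousAt.eventually ((isClosed_half _).isOpen_compl.mem_nhds h)
      filter_upwards [this] with q' h1 h2 using h1 h2.1
  · obtain ⟨s, hs⟩ := exists_mem_half (f q)
    exact ⟨(s, lab s (g q)), hs, rfl⟩
  · obtain ⟨q₀, hq₀, h⟩ := hFmem q v.1 hq.1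
    exact Finset.mem_image.2 ⟨(v.1, q₀), Finset.mem_product.2 ⟨Finset.mem_univ _, hq₀⟩,
      Prod.ext rfl (h.symm.trans hq.2)⟩
  · have hs : w.1 = !v.1 := by
      by_contra h
      have h' : w.1 = v.1 := by
        generalize w.1 = a at h ⊢; generalize v.1 = b at h ⊢; cases a <;> cases b <;> simp_all
      exact hvw (Prod.ext h'.symm (by rw [← hq.2, ← hq'.2, h']))
    have h1 := hq.1
    have h2 := hq'.1
    rw [hs] at h2
    have h0 : (f q).1.2 = 0 := by
      have h1' : 0 ≤ sgn v.1 * (f q).1.2 := h1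
      have h2' : 0 ≤ sgn (!v.1) * (f q).1.2 := h2
      rw [sgn_not] at h2'
      have : sgn v.1 * (f q).1.2 = 0 := by linarith
      exact (mul_eq_zero.1 this).resolve_left (sgn_ne_zero _)
    refine ⟨h0, Prod.ext hs ?_⟩
    rw [← hq'.2, ← hq.2, hs]
    have hb := Z.coordChange_comp (Z.indexAt (f q)) v.1 (!v.1) (f q)
      ⟨⟨hbase _, half_subset_chart _ h1⟩, half_subset_chart _ h2⟩
    have hlab' : ∀ s, lab s (g q) = Z.coordChange (Z.indexAt (f q)) s (f q) (g q).2 := fun s => by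
      rw [hlab, hg']
    change _ = Word.toggle _ (lab v.1 (g q))
    rw [hlab' v.1]
    exact (hlab' _).trans ((hb _).symm.trans (if_neg (by simp)))
  · have e1 : g q = e := g.2 q hq
    have e2 : f q = x := f.2 q hq
    exact ⟨by rw [e2]; exact hs₀, by change lab s₀ (g q) = _; rw [e1, he]⟩

/-- The plane with finitely many collinear punctures is aspherical. -/
theorem piTrivial_linePunctured [Finite N] (hP : P.Finite) : PiTrivial N (LinePunctured P) := by
  intro x f
  obtain ⟨s, S, L, hx, hL⟩ := exists_labelling hP f
  obtain ⟨f', h1, h2⟩ := L.exists_homotopicRel ⟨0, zero_mem_boundary N⟩ s S hL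
  have hb : ∀ q ∈ Cube.boundary N, f' q = x := fun q hq => by
    obtain ⟨H⟩ := h1
    rw [← H.map_one_left q]
    exact (H.prop' 1 q hq).trans (f.2 q hq)
  let p : GenLoop N (LinePunctured P) x := ⟨f', hb⟩
  have h3 : GenLoop.Homotopic f p := h1
  refine h3.trans (homotopic_of_map
    (fun a => ⟨arc s a.1 (f' a.2).1 x.1, arc_mem a.1.2 (h2 a.2) hx⟩) ?_ ?_ ?_ ?_)
  · exact (continuous_arc s (by fun_prop) (by fun_prop) (by fun_prop)).subtype_mk _
  · exact fun q => Subtype.ext (arc_zero _ _ _)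
  · exact fun q => Subtype.ext (arc_one _ _ _)
  · intro t q hq
    refine Subtype.ext ?_
    change arc s t (f' q).1 x.1 = x.1
    rw [hb q hq, arc_self]

end Labels

/-! ### Asphericity of the punctured sphere -/

section PuncturedSphere

variable {N : Type*}

theorem PiTrivial.of_leftInverse {X Y : Type*} [TopologicalSpace X] [TopologicalSpace Y]
    (h : PiTrivial N Y) (f : C(X, Y)) (g : C(Y, X)) (hgf : ∀ x, g (f x) = x) : PiTrivial N X := by
  intro x p
  obtain ⟨H, h0, h1, hb⟩ := exists_map_of_homotopic (h (f x) (genLoopMap f x p))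
  refine homotopic_of_map (fun a => g (H a)) (by fun_prop) (fun y => ?_) (fun y => ?_)
    (fun t y hy => ?_)
  · rw [h0]; exact hgf _
  · rw [h1]; exact hgf _
  · rw [hb t y hy]; exact hgf _

theorem piTrivial_linePunctured_empty : PiTrivial N (LinePunctured ∅) := by
  intro x p
  have hp : Continuous p := p.1.2
  refine homotopic_of_map (fun a => ⟨(1 - (a.1 : ℝ)) • (p a.2).1 + (a.1 : ℝ) • x.1,
    Or.inr (Set.notMem_empty _)⟩) (by fun_prop) (fun y => ?_) (fun y => ?_) (fun t y hy => ?_)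
  · exact Subtype.ext (by simp)
  · exact Subtype.ext (by simp)
  · refine Subtype.ext ?_
    change (1 - (t : ℝ)) • (p y).1 + (t : ℝ) • x.1 = x.1
    rw [show p y = x from p.2 y hy]
    module

theorem exists_shear_injOn {Q : Set (ℝ × ℝ)} (hQ : Q.Finite) :
    ∃ ε : ℝ, Set.InjOn (fun p : ℝ × ℝ => p.1 + ε * p.2) Q := by
  obtain ⟨ε, hε⟩ := ((hQ.prod hQ).image fun a : (ℝ × ℝ) × (ℝ × ℝ) =>
    (a.1.1 - a.2.1) / (a.2.2 - a.1.2)).exists_notMem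
  refine ⟨ε, fun p hp q hq h => ?_⟩
  have h' : p.1 + ε * p.2 = q.1 + ε * q.2 := h
  by_cases hy : p.2 = q.2
  · rw [hy] at h'
    exact Prod.ext (by linarith) hy
  · refine absurd ⟨(p, q), ⟨hp, hq⟩, ?_⟩ hε
    have : q.2 - p.2 ≠ 0 := sub_ne_zero.2 (Ne.symm hy)
    change (p.1 - q.1) / (q.2 - p.2) = ε
    rw [div_eq_iff this]
    linarith

/-- A shear followed by the subtraction of an interpolation polynomial moves any finite set of
points of the plane onto a line. -/
theorem exists_homeomorph_snd_eq_zero {Q : Set (ℝ × ℝ)} (hQ : Q.Finite) :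
    ∃ e : ℝ × ℝ ≃ₜ ℝ × ℝ, ∀ p ∈ Q, (e p).2 = 0 := by
  classical
  obtain ⟨ε, hε⟩ := exists_shear_injOn hQ
  let h : Polynomial ℝ := Lagrange.interpolate hQ.toFinset (fun p => p.1 + ε * p.2) Prod.snd
  have hh : ∀ p ∈ Q, h.eval (p.1 + ε * p.2) = p.2 := fun p hp =>
    Lagrange.eval_interpolate_at_node (v := fun p : ℝ × ℝ => p.1 + ε * p.2) Prod.snd
      (by rwa [hQ.coe_toFinset]) (hQ.mem_toFinset.2 hp)
  have hc := h.continuous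
  refine ⟨{ toFun := fun p => (p.1 + ε * p.2, p.2 - h.eval (p.1 + ε * p.2))
            invFun := fun p => (p.1 - ε * (p.2 + h.eval p.1), p.2 + h.eval p.1)
            left_inv := fun p => ?_
            right_inv := fun p => ?_
            continuous_toFun := by fun_prop
            continuous_invFun := by fun_prop }, fun p hp => ?_⟩
  · ext <;> simp
  · ext <;> simp
  · change p.2 - h.eval (p.1 + ε * p.2) = 0
    rw [hh p hp, sub_self]

variable {J : Type*} [Finite J]

/-- A sphere with at least one puncture is a retract of (in fact homeomorphic to) a plane with
collinear punctures, by stereographic projection from one of the punctures. -/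
theorem exists_linePunctured (a : J → S2) (j₀ : J) :
    ∃ P : Set ℝ, P.Finite ∧ (Subsingleton J → P = ∅) ∧
      ∃ (f : C(Punctured a, LinePunctured P)) (g : C(LinePunctured P, Punctured a)),
        ∀ z, g (f z) = z := by
  have : Fact (Module.finrank ℝ (EuclideanSpace ℝ (Fin 3)) = 2 + 1) := ⟨by simp⟩
  let st := stereographic' 2 (a j₀)
  let c : EuclideanSpace ℝ (Fin 2) ≃ₜ ℝ × ℝ :=
    (EuclideanSpace.equiv (Fin 2) ℝ).toHomeomorph.trans Homeomorph.finTwoArrow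
  let Q : Set (ℝ × ℝ) := (fun j => c (st (a j))) '' {j | a j ≠ a j₀}
  have hQ : Q.Finite := (Set.toFinite _).image _
  obtain ⟨e, he⟩ := exists_homeomorph_snd_eq_zero hQ
  have hsource : ∀ z, z ∈ st.source ↔ z ≠ a j₀ := fun z => by
    rw [stereographic'_source]; rfl
  have htarget : ∀ w, w ∈ st.target := fun w => by
    rw [stereographic'_target]; trivial
  have hf : ∀ z : Punctured a, (e (c (st z.1))).2 ≠ 0 ∨
      (e (c (st z.1))).1 ∉ (fun p => (e p).1) '' Q := fun z => by
    by_contra! h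
    obtain ⟨h2, p, hp, h1⟩ := h
    have : p = c (st z.1) := e.injective (Prod.ext h1 ((he p hp).trans h2.symm))
    obtain ⟨j, hj, rfl⟩ := hp
    exact z.2 j (st.injOn ((hsource _).2 (z.2 j₀)) ((hsource _).2 hj) (c.injective this).symm)
  have hg : ∀ w : LinePunctured ((fun p => (e p).1) '' Q), ∀ j,
      st.symm (c.symm (e.symm w.1)) ≠ a j := fun w j h => by
    have hs := st.map_target (htarget (c.symm (e.symm w.1)))
    have hj : a j ≠ a j₀ := (hsource _).1 (h ▸ hs)
    have h1 : c (st (a j)) = e.symm w.1 := by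
      rw [← h, st.right_inv (htarget _), c.apply_symm_apply]
    have hjQ : c (st (a j)) ∈ Q := ⟨j, hj, rfl⟩
    have h2 : e (c (st (a j))) = w.1 := by rw [h1, e.apply_symm_apply]
    rcases w.2 with h' | h'
    · exact h' (by rw [← h2, he _ hjQ])
    · exact h' ⟨_, hjQ, by rw [← h2]⟩
  have hst : Continuous fun z : Punctured a => st z.1 :=
    st.continuousOn.comp_continuous continuous_subtype_val fun z => (hsource _).2 (z.2 j₀)
  have hst' : Continuous st.symm := by
    have := st.symm.continuousOn
    rwa [st.symm_source, stereographic'_target, continuousOn_univ] at this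
  refine ⟨(fun p => (e p).1) '' Q, hQ.image _, fun hJ => ?_,
    ⟨fun z => ⟨e (c (st z.1)), hf z⟩,
      (e.continuous.comp (c.continuous.comp hst)).subtype_mk _⟩,
    ⟨fun w => ⟨st.symm (c.symm (e.symm w.1)), hg w⟩,
      (hst'.comp (c.symm.continuous.comp
        (e.symm.continuous.comp continuous_subtype_val))).subtype_mk _⟩, fun z => ?_⟩
  · have : Q = ∅ := Set.eq_empty_of_forall_notMem fun p ⟨j, hj, _⟩ =>
      hj (congrArg a (Subsingleton.elim j j₀))
    rw [this, Set.image_empty]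
  · refine Subtype.ext ?_
    change st.symm (c.symm (e.symm (e (c (st z.1))))) = z.1
    rw [e.symm_apply_apply, c.symm_apply_apply, st.left_inv ((hsource _).2 (z.2 j₀))]

theorem piTrivial_punctured [Nontrivial N] [Finite N] [Nonempty J] (a : J → S2) :
    PiTrivial N (Punctured a) := by
  obtain ⟨P, hP, -, f, g, h⟩ := exists_linePunctured a (Classical.arbitrary J)
  exact (piTrivial_linePunctured hP).of_leftInverse f g h

theorem piTrivial_punctured_of_subsingleton [Nonempty J] [hJ : Subsingleton J] (a : J → S2) :
    PiTrivial N (Punctured a) := by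
  obtain ⟨P, -, hP, f, g, h⟩ := exists_linePunctured a (Classical.arbitrary J)
  obtain rfl := hP hJ
  exact piTrivial_linePunctured_empty.of_leftInverse f g h

end PuncturedSphere

/-! ### Configurations on the sphere and their coordinates -/

section SphConf

/-- Configurations of `n` points on the sphere which, if `s` holds, are moreover never antipodal.
For `s = False` this is the configuration space of the sphere; for `s = True` it is a covering
space of the configuration space of the projective plane. -/
abbrev SphConf (n : ℕ) (s : Prop) : Type :=
  {x : Fin n → S2 // ∀ i j, i ≠ j → x i ≠ x j ∧ (s → x i ≠ -x j)}

@[fun_prop]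
theorem continuous_sphConf_apply {n : ℕ} {s : Prop} (i : Fin n) :
    Continuous fun x : SphConf n s => x.1 i :=
  (continuous_apply i).comp continuous_subtype_val

/-- The projection onto the `i`-th point. -/
def sphProj (n : ℕ) (s : Prop) (i : Fin n) : C(SphConf n s, S2) :=
  ⟨fun x => x.1 i, continuous_sphConf_apply i⟩

/-- Index set of the points that are forbidden for a further point of a configuration of `n`
points: these points and, if `s` holds, their antipodes (marked by `true`). -/
abbrev Forbidden (n : ℕ) (s : Prop) : Type := {p : Fin n × Bool // p.2 = true → s}

/-- The points that are forbidden for a further point of a configuration. -/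
noncomputable def forbidden (n : ℕ) (s : Prop) (p : Forbidden n s) : C(SphConf n s, S2) :=
  ⟨fun x => if p.1.2 then -x.1 p.1.1 else x.1 p.1.1, by
    split_ifs
    · exact continuous_neg.comp (continuous_sphConf_apply _)
    · exact continuous_sphConf_apply _⟩

theorem ne_neg_self (x : S2) : x ≠ -x := fun h => by
  have h1 : (x : EuclideanSpace ℝ (Fin 3)) = -x := congrArg Subtype.val h
  have h2 : (x : EuclideanSpace ℝ (Fin 3)) = 0 := by
    have : (2 : ℝ) • (x : EuclideanSpace ℝ (Fin 3)) = 0 := by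
      rw [two_smul]; exact eq_neg_iff_add_eq_zero.1 h1
    exact (smul_eq_zero.1 this).resolve_left two_ne_zero
  have := mem_sphere_zero_iff_norm.1 x.2
  simp [h2] at this

theorem injective_forbidden {n : ℕ} {s : Prop} (x : SphConf n s) :
    Function.Injective fun p => forbidden n s p x := by
  rintro ⟨⟨i, b⟩, hb⟩ ⟨⟨j, b'⟩, hb'⟩ h
  by_cases hij : i = j
  · subst hij
    cases b <;> cases b'
    · rfl
    · exact absurd h (ne_neg_self _)
    · exact absurd h.symm (ne_neg_self _)
    · rfl
  · exfalso
    obtain ⟨h1, h2⟩ := x.2 i j hij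
    cases b <;> cases b'
    · exact h1 h
    · exact h2 (hb' rfl) h
    · exact h2 (hb rfl) (neg_eq_iff_eq_neg.1 h)
    · exact h1 (neg_injective h)

/-- A configuration of `n + 1` points is a configuration of `n` points together with a point that
is not forbidden. -/
noncomputable def sphConfSuccHomeomorph (n : ℕ) (s : Prop) :
    SphConf (n + 1) s ≃ₜ AvoidSpace (forbidden n s) where
  toFun x := ⟨(⟨fun i => x.1 i.castSucc, fun i j hij =>
      x.2 _ _ fun h => hij (Fin.castSucc_injective n h)⟩, x.1 (Fin.last n)), by
    rintro ⟨⟨i, b⟩, hb⟩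
    obtain ⟨h1, h2⟩ := x.2 (Fin.last n) i.castSucc (Fin.castSucc_ne_last i).symm
    cases b
    · exact h1
    · exact h2 (hb rfl)⟩
  invFun p := ⟨Fin.snoc (α := fun _ => S2) p.1.1.1 p.1.2, by
    intro i j
    have h1 : ∀ i, p.1.2 ≠ p.1.1.1 i := fun i => p.2 ⟨(i, false), by simp⟩
    have h2 : s → ∀ i, p.1.2 ≠ -p.1.1.1 i := fun hs i => p.2 ⟨(i, true), fun _ => hs⟩
    induction i using Fin.lastCases with
    | last =>
      induction j using Fin.lastCases with
      | last => exact fun h => absurd rfl h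
      | cast j =>
        intro _
        simp only [Fin.snoc_last, Fin.snoc_castSucc]
        exact ⟨h1 j, fun hs => h2 hs j⟩
    | cast i =>
      induction j using Fin.lastCases with
      | last =>
        intro _
        simp only [Fin.snoc_last, Fin.snoc_castSucc]
        exact ⟨(h1 i).symm, fun hs h => h2 hs i (by rw [h, neg_neg])⟩
      | cast j =>
        intro hij
        simp only [Fin.snoc_castSucc]
        exact p.1.1.2 i j fun h => hij (by rw [h])⟩
  left_inv x := Subtype.ext (Fin.snoc_init_self (α := fun _ => S2) x.1)
  right_inv p := Subtype.ext (Prod.ext (Subtype.ext (funext fun i => Fin.snoc_castSucc (α := fun _ => S2) ..))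
    (Fin.snoc_last (α := fun _ => S2) ..))
  continuous_toFun := by
    refine Continuous.subtype_mk (Continuous.prodMk (Continuous.subtype_mk ?_ _) ?_) _
    · exact continuous_pi fun i => continuous_sphConf_apply _
    · exact continuous_sphConf_apply _
  continuous_invFun := by
    refine Continuous.subtype_mk ?_ _
    exact Continuous.finSnoc (by fun_prop) (by fun_prop)

/-- A configuration of one point is a point. -/
def sphConfOneHomeomorph (s : Prop) : SphConf 1 s ≃ₜ S2 where
  toFun x := x.1 0
  invFun z := ⟨fun _ => z, fun i j h => absurd (Subsingleton.elim i j) h⟩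
  left_inv x := Subtype.ext (funext fun i => congrArg x.1 (Subsingleton.elim 0 i))
  right_inv _ := rfl
  continuous_toFun := continuous_sphConf_apply 0
  continuous_invFun := by fun_prop

/-- Renumbering the points of a configuration. -/
def sphConfPerm (n : ℕ) (s : Prop) (e : Equiv.Perm (Fin n)) : SphConf n s ≃ₜ SphConf n s where
  toFun x := ⟨fun i => x.1 (e i), fun _ _ h => x.2 _ _ (e.injective.ne h)⟩
  invFun x := ⟨fun i => x.1 (e.symm i), fun _ _ h => x.2 _ _ (e.symm.injective.ne h)⟩
  left_inv x := by simp
  right_inv x := by simp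
  continuous_toFun := (continuous_pi fun _ => continuous_sphConf_apply _).subtype_mk _
  continuous_invFun := (continuous_pi fun _ => continuous_sphConf_apply _).subtype_mk _

theorem sphProj_eq_comp_swap (n : ℕ) (s : Prop) (i : Fin (n + 1)) :
    sphProj (n + 1) s i =
      (sphProj (n + 1) s 0).comp (sphConfPerm (n + 1) s (Equiv.swap 0 i) : C(_, _)) := by
  ext1 x
  change x.1 i = x.1 (Equiv.swap 0 i 0)
  rw [Equiv.swap_apply_left]

theorem sphProj_zero_succ (n : ℕ) (s : Prop) :
    sphProj (n + 2) s 0 = (sphProj (n + 1) s 0).comp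
      ((avoidProj (forbidden (n + 1) s)).comp (sphConfSuccHomeomorph (n + 1) s : C(_, _))) :=
  rfl

instance (n : ℕ) (s : Prop) : Nonempty (Forbidden (n + 1) s) := ⟨⟨(0, false), by simp⟩⟩

instance : Subsingleton (Forbidden (0 + 1) False) :=
  ⟨fun ⟨⟨i, b⟩, hb⟩ ⟨⟨j, b'⟩, hb'⟩ => by
    have h1 : b = false := by simpa using hb
    have h2 : b' = false := by simpa using hb'
    subst h1 h2
    obtain rfl := Subsingleton.elim (α := Fin 1) i j
    rfl⟩

variable {N : Type*} [Fintype N]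

theorem piInj_sphProj [Nontrivial N] (n : ℕ) (s : Prop) (i : Fin (n + 1)) :
    PiInj N (sphProj (n + 1) s i) := by
  rw [sphProj_eq_comp_swap]
  refine PiInj.comp ?_ (piInj_homeomorph _)
  induction n with
  | zero => exact piInj_homeomorph (sphConfOneHomeomorph s)
  | succ n ih =>
    have := Fintype.ofFinite (Forbidden (n + 1) s)
    rw [sphProj_zero_succ]
    exact (ih 0).comp ((piInj_avoidProj _ injective_forbidden fun x =>
      piTrivial_punctured _).comp (piInj_homeomorph _))

theorem piSurj_sphProj [DecidableEq N] (k : N) [Nontrivial {j // j ≠ k}] (n : ℕ) (s : Prop)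
    (i : Fin (n + 1)) : PiSurj N (sphProj (n + 1) s i) := by
  rw [sphProj_eq_comp_swap]
  refine PiSurj.comp ?_ (piSurj_homeomorph _)
  induction n with
  | zero => exact piSurj_homeomorph (sphConfOneHomeomorph s)
  | succ n ih =>
    have := Fintype.ofFinite (Forbidden (n + 1) s)
    rw [sphProj_zero_succ]
    exact (ih 0).comp ((piSurj_avoidProj k _ injective_forbidden fun x =>
      piTrivial_punctured _).comp (piSurj_homeomorph _))

/-- For two points on the sphere the fibre of the projection is a plane. -/
theorem piSurj_sphProj_two [DecidableEq N] (k : N) (i : Fin 2) : PiSurj N (sphProj 2 False i) := by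
  rw [sphProj_eq_comp_swap]
  refine PiSurj.comp ?_ (piSurj_homeomorph _)
  have := Fintype.ofFinite (Forbidden 1 False)
  rw [sphProj_zero_succ]
  exact PiSurj.comp (piSurj_homeomorph (sphConfOneHomeomorph False))
    ((piSurj_avoidProj k _ injective_forbidden fun x =>
      piTrivial_punctured_of_subsingleton _).comp (piSurj_homeomorph _))

end SphConf

/-! ### Configurations on the projective plane -/

section Projective

/-- The quotient map from the sphere to the projective plane. -/
def toRP2 : C(S2, RP2) := ⟨Quotient.mk antipodalSetoid, continuous_quotient_mk'⟩

theorem toRP2_eq_iff {x y : S2} : toRP2 x = toRP2 y ↔ x = y ∨ x = -y := Quotient.eq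

theorem isCoveringMap_toRP2 : IsCoveringMap toRP2 := by
  let : MulAction ℤˣ S2 :=
    { smul := fun u x => if u = 1 then x else -x
      one_smul := fun x => if_pos rfl
      mul_smul := fun u v x => by
        change ite _ _ _ = ite _ (ite _ _ _) (-ite _ _ _)
        rcases Int.units_eq_one_or u with rfl | rfl <;>
          rcases Int.units_eq_one_or v with rfl | rfl <;> simp }
  have one_sm : ∀ x : S2, (1 : ℤˣ) • x = x := fun x => one_smul _ x
  have neg_sm : ∀ x : S2, (-1 : ℤˣ) • x = -x := fun x => if_neg (by decide)
  have hq : IsQuotientCoveringMap toRP2 ℤˣ :=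
    { toIsQuotientMap := isQuotientMap_quotient_mk'
      continuous_const_smul := fun u => by
        rcases Int.units_eq_one_or u with rfl | rfl
        · simpa only [one_sm] using continuous_id'
        · simpa only [neg_sm] using continuous_neg
      apply_eq_iff_mem_orbit := fun {x y} => by
        rw [toRP2_eq_iff, MulAction.mem_orbit_iff]
        constructor
        · rintro (h | h)
          · exact ⟨1, by rw [one_sm, h]⟩
          · exact ⟨-1, by rw [neg_sm, h]⟩
        · rintro ⟨u, hu⟩
          rcases Int.units_eq_one_or u with rfl | rfl
          · exact Or.inl (by rw [← hu, one_sm])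
          · exact Or.inr (by rw [← hu, neg_sm])
      disjoint := fun x => by
        -- an open ball of radius one contains no antipodal points
        refine ⟨Metric.ball x 1, Metric.ball_mem_nhds x one_pos, fun u => ?_⟩
        rintro ⟨_, ⟨y, hy, rfl⟩, hy'⟩
        rcases Int.units_eq_one_or u with rfl | rfl
        · rfl
        · exfalso
          have h1 : dist (-y) x < 1 := by rw [← neg_sm]; exact hy'
          have h2 : dist y x < 1 := hy
          have h3 := dist_triangle_right y (-y) x
          have h4 : dist y (-y) = 2 := by
            rw [Subtype.dist_eq, dist_eq_norm]
            change ‖(y : EuclideanSpace ℝ (Fin 3)) - -y‖ = 2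
            rw [sub_neg_eq_add, ← two_smul ℝ, norm_smul, mem_sphere_zero_iff_norm.1 y.2]
            norm_num
          linarith }
  exact hq.isCoveringMap

/-- The covering map from configurations on the sphere without antipodal points to configurations on
the projective plane. -/
def confToRP2 (n : ℕ) : C(SphConf n True, Conf n RP2) :=
  ⟨fun x => ⟨fun i => toRP2 (x.1 i), fun i j hij h => by
    obtain ⟨h1, h2⟩ := x.2 i j hij
    rcases toRP2_eq_iff.1 h with h | h
    · exact h1 h
    · exact h2 trivial h⟩,
    (continuous_pi fun i => toRP2.continuous.comp (continuous_sphConf_apply i)).subtype_mk _⟩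

theorem mem_sphConf_of_toRP2 {n : ℕ} (y : Conf n RP2) (x : Fin n → S2)
    (h : ∀ i, toRP2 (x i) = y.1 i) : ∀ i j, i ≠ j → x i ≠ x j ∧ (True → x i ≠ -x j) := by
  intro i j hij
  have := y.2 i j hij
  rw [← h, ← h, Ne, toRP2_eq_iff, not_or] at this
  exact ⟨this.1, fun _ => this.2⟩

theorem surjective_confToRP2 (n : ℕ) : Function.Surjective (confToRP2 n) := fun y => by
  choose x hx using fun i => (Quotient.mk_surjective (s := antipodalSetoid)) (y.1 i)
  exact ⟨⟨x, mem_sphConf_of_toRP2 y x hx⟩, Subtype.ext (funext hx)⟩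

/-- Loops of configurations are lifted point by point. -/
theorem piSurj_confToRP2 {N : Type*} [Nontrivial N] (n : ℕ) : PiSurj N (confToRP2 n) := by
  intro x f
  choose g hg using fun i => exists_lift_genLoop isCoveringMap_toRP2 (x.1 i)
    (genLoopMap (confProj n RP2 i) (confToRP2 n x) f)
  have hg' : ∀ y i, toRP2 (g i y) = (f y).1 i := fun y i => hg i y
  have hgc : ∀ i, Continuous (g i) := fun i => (g i).1.2
  let p : GenLoop N (SphConf n True) x :=
    ⟨⟨fun y => ⟨fun i => g i y, mem_sphConf_of_toRP2 (f y) _ (hg' y)⟩, by fun_prop⟩,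
      fun y hy => Subtype.ext (funext fun i => (g i).2 y hy)⟩
  have hp : genLoopMap (confToRP2 n) x p = f :=
    GenLoop.ext _ _ fun y => Subtype.ext (funext fun i => hg' y i)
  exact ⟨p, by rw [hp]⟩

end Projective

/-! ### The coordinates of a configuration on either surface -/

section Coordinates

theorem piInj_confIncl {N M : Type*} [TopologicalSpace M] {n : ℕ} (i : Fin n)
    (h : PiInj N (confProj n M i)) : PiInj N (confIncl n M) :=
  PiInj.of_comp (g := (⟨fun x => x i, by fun_prop⟩ : C(Fin n → M, M))) h

variable {N : Type*} [Fintype N] {n : ℕ}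

/-- Configurations on the sphere as instances of `SphConf`. -/
def confS2Homeomorph (n : ℕ) : Conf n S2 ≃ₜ SphConf n False where
  toFun x := ⟨x.1, fun i j h => ⟨x.2 i j h, False.elim⟩⟩
  invFun x := ⟨x.1, fun i j h => (x.2 i j h).1⟩
  left_inv _ := rfl
  right_inv _ := rfl
  continuous_toFun := by fun_prop
  continuous_invFun := by fun_prop

theorem confProj_S2_eq (i : Fin n) :
    confProj n S2 i = (sphProj n False i).comp (confS2Homeomorph n : C(_, _)) := rfl

theorem confProj_comp_confToRP2 (i : Fin n) :
    (confProj n RP2 i).comp (confToRP2 n) = toRP2.comp (sphProj n True i) := rfl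

theorem piInj_confProj_S2 [Nontrivial N] (i : Fin (n + 1)) : PiInj N (confProj (n + 1) S2 i) := by
  rw [confProj_S2_eq]
  exact (piInj_sphProj n False i).comp (piInj_homeomorph _)

theorem piSurj_confProj_S2 [DecidableEq N] (k : N) [Nontrivial {j // j ≠ k}] (i : Fin (n + 1)) :
    PiSurj N (confProj (n + 1) S2 i) := by
  rw [confProj_S2_eq]
  exact (piSurj_sphProj k n False i).comp (piSurj_homeomorph _)

theorem piSurj_confProj_S2_two [DecidableEq N] (k : N) (i : Fin 2) :
    PiSurj N (confProj 2 S2 i) := by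
  rw [confProj_S2_eq]
  exact (piSurj_sphProj_two k i).comp (piSurj_homeomorph _)

theorem piInj_confProj_RP2 [Nontrivial N] (i : Fin (n + 1)) : PiInj N (confProj (n + 1) RP2 i) := by
  refine PiInj.of_comp_of_piSurj (f := confToRP2 (n + 1)) ?_ (piSurj_confToRP2 _)
    (surjective_confToRP2 _)
  rw [confProj_comp_confToRP2]
  exact (piInj_of_isCoveringMap isCoveringMap_toRP2).comp (piInj_sphProj n True i)

theorem piSurj_confProj_RP2 [DecidableEq N] [Nontrivial N] (k : N) [Nontrivial {j // j ≠ k}]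
    (i : Fin (n + 1)) : PiSurj N (confProj (n + 1) RP2 i) := by
  refine PiSurj.of_comp (f := confToRP2 (n + 1)) ?_ (surjective_confToRP2 _)
  rw [confProj_comp_confToRP2]
  exact (piSurj_of_isCoveringMap isCoveringMap_toRP2).comp (piSurj_sphProj k n True i)

end Coordinates

end SurfaceConf

theorem lemma3 (n k : ℕ) (hn : 2 ≤ n) (hk : 2 ≤ k) [NeZero k] :
    -- the 2-sphere
    (∀ x : SurfaceConf.Conf n SurfaceConf.S2,
      ((3 ≤ k ∨ (k = 2 ∧ n = 2)) → ∀ i : Fin n,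
        Function.Bijective (SurfaceConf.piHom k (SurfaceConf.confProj n SurfaceConf.S2 i) x)) ∧
      Function.Injective (SurfaceConf.piHom k (SurfaceConf.confIncl n SurfaceConf.S2) x)) ∧
    -- the real projective plane
    (∀ x : SurfaceConf.Conf n SurfaceConf.RP2,
      (3 ≤ k → ∀ i : Fin n,
        Function.Bijective (SurfaceConf.piHom k (SurfaceConf.confProj n SurfaceConf.RP2 i) x)) ∧
      Function.Injective (SurfaceConf.piHom k (SurfaceConf.confIncl n SurfaceConf.RP2) x)) := by
  open SurfaceConf in
  obtain ⟨m, rfl⟩ : ∃ m, n = m + 1 := ⟨n - 1, by omega⟩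
  have : Nontrivial (Fin k) := Fin.nontrivial_iff_two_le.2 hk
  have hface : 3 ≤ k → Nontrivial {j : Fin k // j ≠ 0} := fun h =>
    ⟨⟨⟨1, by omega⟩, by simp [Fin.ext_iff]⟩, ⟨⟨2, by omega⟩, by simp [Fin.ext_iff]⟩,
      by simp [Fin.ext_iff]⟩
  refine ⟨fun x => ⟨fun h i => ⟨piHom_injective (piInj_confProj_S2 i) x, ?_⟩,
    piHom_injective (piInj_confIncl 0 (piInj_confProj_S2 0)) x⟩,
    fun x => ⟨fun h i => ⟨piHom_injective (piInj_confProj_RP2 i) x, ?_⟩,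
    piHom_injective (piInj_confIncl 0 (piInj_confProj_RP2 0)) x⟩⟩
  · rcases h with h | ⟨-, h⟩
    · have := hface h
      exact piHom_surjective (piSurj_confProj_S2 0 i) x
    · obtain rfl : m = 1 := by omega
      exact piHom_surjective (piSurj_confProj_S2_two 0 i) x
  · have := hface h
    exact piHom_surjective (piSurj_confProj_RP2 0 i) x
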